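/- Let $k$ be a field of characteristic $0$. A closed subscheme $Y\subset\mathbb P^n_k$ has maximal rank in degree $d\ge 0$ if the restriction map $H^0(\mathbb P^n,\mathcal O_{\mathbb P^n}(d))\to H^0(Y,\mathcal O_Y(d))$ is injective or surjective. A finite sequence of lines in $\mathbb P^n_k$ is in general position if the lines are distinct, are pairwise disjoint when $n\ge 3$, and for every subset of them the (reduced) union of that subset has maximal rank in every degree. For a line $L$, a point $x\in L$ and $r\ge 0$, the $r$-jet on $L$ at $x$ is the divisor $r\cdot x$ of $L$, viewed as a closed subscheme of $\mathbb P^n_k$. A statement about generic points of given lines, or of $\mathbb P^n$, means that it holds for all choices of the points in some nonempty Zariski open subset of the product of these varieties; the generic $r$-jet on $L$ is the $r$-jet at the generic point of $L$. For integers $n,d\ge 0$ and positive integers $r_1\ge\dots\ge r_m$, let $C(n,d)$ be the condition: $r_1\le d+1$ (if $m\ge 1$) and, if $n=2$, then $$r_1+\dots+r_s\le ds+1-\binom{s-1}{2}\qquad\text{for } 1\le s\le d+1,$$ where $r_i=0$ for $i>m$. For an integer $\chi\ge 0$, call $(\chi,r_1,\dots,r_m)$ $d$-admissible if $r_1\ge\dots\ge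 r_m\ge 1$, $\chi+r_1+\dots+r_m=\binom{n+d}{d}$ and $C(n,d)$ holds. Theorem. Let $L_1,\dots,L_m$ be lines in general position in $\mathbb P^n_k$, let $r_1\ge\dots\ge r_m$ be positive integers, and let $d\ge 0$ be an integer such that $r_1+\dots+r_m\le\binom{n+d}{d}$. Then the union $J_1\cup\dots\cup J_m$, where $J_i$ is the generic $r_i$-jet on $L_i$, has maximal rank in degree $d$ if and only if $C(n,d)$ holds. Moreover, if $(\chi,r_1,\dots,r_m)$ is $d$-admissible, then the union of $J_1\cup\dots\cup J_m$ with $\chi$ generic points of $\mathbb P^n$ has maximal rank in degree $d$. -/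

import Mathlib

open scoped LinearAlgebra.Projectivization

noncomputable section

namespace JetInterpolation

/-- The homogeneous coordinate ring of projective `n`-space over `k`. -/
abbrev CoordRing (k : Type*) [Field k] (n : ℕ) : Type _ := MvPolynomial (Fin (n + 1)) k

/-- The affine cone over projective `n`-space. -/
abbrev Cone (k : Type*) [Field k] (n : ℕ) : Type _ := Fin (n + 1) → k

variable {k : Type*} [Field k] {n : ℕ}

/-! ### Sections of `O_Y(d)` on a closed subscheme `Y = V₊(I)` of projective space, and
maximal rank

`Y` is covered by the affine charts `D₊(X_i)`, and `O_Y(d)` on `D₊(X_i)` is the degree `d` part of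
the graded ring `(S / I)[1 / X_i]`. A global section is a family of local sections that agree on
the overlaps `D₊(X_i X_j)`. -/

/-- The image of the coordinate `X_i` in `S / I`. -/
abbrev coord (I : Ideal (CoordRing k n)) (i : Fin (n + 1)) : CoordRing k n ⧸ I :=
  Ideal.Quotient.mk I (MvPolynomial.X i)

/-- The graded ring `(S / I)[1 / X_i]`. -/
abbrev Chart (I : Ideal (CoordRing k n)) (i : Fin (n + 1)) : Type _ :=
  Localization.Away (coord I i)

/-- The graded ring `(S / I)[1 / (X_i X_j)]`. -/
abbrev Overlap (I : Ideal (CoordRing k n)) (i j : Fin (n + 1)) : Type _ :=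
  Localization.Away (coord I i * coord I j)

/-- The degree `d` part of `(S / I)[1 / X_i]`: the fractions `p / X_i ^ N` with `p` homogeneous of
degree `d + N`. -/
def chartSections (I : Ideal (CoordRing k n)) (d : ℕ) (i : Fin (n + 1)) :
    Submodule k (Chart I i) where
  carrier := {f | ∃ (N : ℕ) (p : CoordRing k n), p.IsHomogeneous (d + N) ∧
    algebraMap _ (Chart I i) (coord I i) ^ N * f =
      algebraMap _ (Chart I i) (Ideal.Quotient.mk I p)}
  zero_mem' := ⟨0, 0, MvPolynomial.isHomogeneous_zero _ _ _, by simp⟩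
  add_mem' := by
    rintro f g ⟨N, p, hp, hf⟩ ⟨M, q, hq, hg⟩
    refine ⟨N + M, MvPolynomial.X i ^ M * p + MvPolynomial.X i ^ N * q, ?_, ?_⟩
    · refine MvPolynomial.IsHomogeneous.add ?_ ?_
      · have h := (MvPolynomial.isHomogeneous_X_pow (R := k) i M).mul hp
        rwa [show M + (d + N) = d + (N + M) by omega] at h
      · have h := (MvPolynomial.isHomogeneous_X_pow (R := k) i N).mul hq
        rwa [show N + (d + M) = d + (N + M) by omega] at h
    · simp only [map_add, map_mul, map_pow, ← hf, ← hg]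
      ring
  smul_mem' := by
    rintro c f ⟨N, p, hp, hf⟩
    refine ⟨N, c • p, ?_, ?_⟩
    · exact (MvPolynomial.homogeneousSubmodule (Fin (n + 1)) k (d + N)).smul_mem c hp
    · rw [mul_smul_comm, hf]
      exact (map_smul (IsScalarTower.toAlgHom k (CoordRing k n ⧸ I) (Chart I i)) c
        (Ideal.Quotient.mk I p)).symm

/-- The space `H⁰(Y, O_Y(d))` for `Y = V₊(I)`. -/
def globalSections (I : Ideal (CoordRing k n)) (d : ℕ) :
    Submodule k (∀ i : Fin (n + 1), Chart I i) where
  carrier := {f | (∀ i, f i ∈ chartSections I d i) ∧ ∀ i j,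
    IsLocalization.Away.awayToAwayRight (P := Overlap I i j) (coord I i) (coord I j) (f i) =
      IsLocalization.Away.awayToAwayLeft (P := Overlap I i j) (coord I j) (coord I i) (f j)}
  zero_mem' := ⟨fun i => (chartSections I d i).zero_mem, fun i j => by simp⟩
  add_mem' := by
    rintro f g ⟨hf, hf'⟩ ⟨hg, hg'⟩
    exact ⟨fun i => (chartSections I d i).add_mem (hf i) (hg i), fun i j => by
      simp only [Pi.add_apply, map_add, hf', hg']⟩
  smul_mem' := by
    rintro c f ⟨hf, hf'⟩
    refine ⟨fun i => (chartSections I d i).smul_mem c (hf i), fun i j => ?_⟩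
    have key : ∀ l, (c • f) l =
        algebraMap (CoordRing k n ⧸ I) (Chart I l) (algebraMap k _ c) * f l := by
      intro l
      rw [Pi.smul_apply, Algebra.smul_def, ← IsScalarTower.algebraMap_apply]
    simp only [key, map_mul, hf', IsLocalization.Away.awayToAwayRight_eq,
      IsLocalization.Away.awayToAwayLeft_eq]

/-- The canonical map `H⁰(ℙⁿ, O(d)) → H⁰(Y, O_Y(d))` for `Y = V₊(I)`; its source is the space of
forms of degree `d`. -/
def restriction (I : Ideal (CoordRing k n)) (d : ℕ) :
    MvPolynomial.homogeneousSubmodule (Fin (n + 1)) k d →ₗ[k] globalSections I d where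
  toFun p := ⟨fun i => algebraMap _ (Chart I i) (Ideal.Quotient.mk I (p : CoordRing k n)),
    fun i => ⟨0, p, p.2, by simp⟩, fun i j => by
      rw [IsLocalization.Away.awayToAwayRight_eq, IsLocalization.Away.awayToAwayLeft_eq]⟩
  map_add' p q := by
    ext i
    simp
  map_smul' c p := by
    ext i
    exact map_smul (IsScalarTower.toAlgHom k (CoordRing k n ⧸ I) (Chart I i)) c
      (Ideal.Quotient.mk I (p : CoordRing k n))

/-- The closed subscheme `V₊(I)` of projective space has maximal rank in degree `d`: the map
`H⁰(ℙⁿ, O(d)) → H⁰(Y, O_Y(d))` is injective or surjective. -/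
def HasMaximalRank (I : Ideal (CoordRing k n)) (d : ℕ) : Prop :=
  Function.Injective (restriction I d) ∨ Function.Surjective (restriction I d)

/-! ### Lines, jets and their unions -/

/-- The homogeneous ideal of the linear subvariety of projective space whose affine cone is the
linear subspace `W` (over an infinite field). -/
def linearIdeal (W : Submodule k (Cone k n)) : Ideal (CoordRing k n) :=
  MvPolynomial.vanishingIdeal k (W : Set (Cone k n))

/-- The ideal of the `r`-jet with support `x` on the line `ℙ(L)`, that is, of the divisor `r • x`
on that line (empty for `r = 0`). -/
def jetIdeal (L : Submodule k (Cone k n)) (x : ℙ k (Cone k n)) (r : ℕ) : Ideal (CoordRing k n) :=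
  linearIdeal L ⊔ linearIdeal x.submodule ^ r

/-- The lines `ℙ(L i)` are in general position: they are lines, distinct, pairwise disjoint if the
ambient space has dimension at least three, and the union of any subset of them has maximal rank in
any degree. -/
structure InGeneralPosition {m : ℕ} (L : Fin m → Submodule k (Cone k n)) : Prop where
  isLine : ∀ i, Module.finrank k (L i) = 2
  distinct : Function.Injective L
  skew : 3 ≤ n → ∀ i j, i ≠ j → Disjoint (L i) (L j)
  maximalRank : ∀ (T : Finset (Fin m)) (d : ℕ), HasMaximalRank (⨅ i ∈ T, linearIdeal (L i)) d

/-- `P` holds for the generic choice of points `x i ∈ ℙ(W i)`, that is, on a nonempty Zariski open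
subset of the product of the `ℙ(W i)`: it holds for all points whose homogeneous coordinates are not
a zero of `G`, where `G` is a polynomial which is nonzero somewhere on the product. -/
def HoldsGenerically {ι : Type*} (W : ι → Submodule k (Cone k n))
    (P : (ι → ℙ k (Cone k n)) → Prop) : Prop :=
  ∃ G : MvPolynomial (ι × Fin (n + 1)) k,
    (∃ v : ι → Cone k n, (∀ i, v i ∈ W i ∧ v i ≠ 0) ∧
      MvPolynomial.eval (fun a => v a.1 a.2) G ≠ 0) ∧
    ∀ (v : ι → Cone k n) (hv : ∀ i, v i ≠ 0), (∀ i, v i ∈ W i) →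
      MvPolynomial.eval (fun a => v a.1 a.2) G ≠ 0 →
        P (fun i => Projectivization.mk k (v i) (hv i))

/-- The union of the generic `r i`-jets on the lines `ℙ(L i)` has maximal rank in degree `d`. -/
def GenericJetsHaveMaximalRank {m : ℕ} (L : Fin m → Submodule k (Cone k n)) (r : Fin m → ℕ)
    (d : ℕ) : Prop :=
  HoldsGenerically L fun x => HasMaximalRank (⨅ i, jetIdeal (L i) (x i) (r i)) d

/-- The union of the generic `r i`-jets on the lines `ℙ(L i)` and of `χ` generic points of the
projective space has maximal rank in degree `d`. -/
def GenericJetsAndPointsHaveMaximalRank {m : ℕ} (L : Fin m → Submodule k (Cone k n))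
    (χ : ℕ) (r : Fin m → ℕ) (d : ℕ) : Prop :=
  HoldsGenerically (Sum.elim L fun _ : Fin χ => (⊤ : Submodule k (Cone k n))) fun x =>
    HasMaximalRank ((⨅ i, jetIdeal (L i) (x (Sum.inl i)) (r i)) ⊓
      ⨅ j, linearIdeal (x (Sum.inr j)).submodule) d

/-! ### The numerical conditions -/

/-- The condition `C(n, d)`: the first length is at most `d + 1` and, if `n = 2`, then
`r_1 + ⋯ + r_s ≤ d s + 1 - (s - 1 choose 2)` for `1 ≤ s ≤ d + 1`, where lengths beyond the end of
the sequence count as zero. -/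
def NumericalCondition (n d : ℕ) {m : ℕ} (r : Fin m → ℕ) : Prop :=
  (∀ h : 0 < m, r ⟨0, h⟩ ≤ d + 1) ∧
    (n = 2 → ∀ s : ℕ, 1 ≤ s → s ≤ d + 1 →
      ∑ i : Fin m with i.val < s, (r i : ℤ) ≤ d * s + 1 - ((s - 1).choose 2 : ℤ))

/-- The sequence `(χ, r_1, …, r_m)` is `d`-admissible. -/
structure IsAdmissible (n d : ℕ) {m : ℕ} (χ : ℕ) (r : Fin m → ℕ) : Prop where
  sum_eq : χ + ∑ i, r i = (n + d).choose d
  antitone : Antitone r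
  pos : ∀ i, 1 ≤ r i
  condition : NumericalCondition n d r

end JetInterpolation

end

/-!
Every closed subscheme in the statement is described, on forms, by Taylor coefficients: a form `p`
lies in the ideal of the `r`-jet at `v` on the line spanned by `v` and `w` if and only if `X ^ r`
divides the one-variable polynomial `p(v + X • w)`, in the ideal of the line if and only if this
polynomial is zero, and in the ideal of the point `v` if and only if `p(v) = 0`, which is the case
`w = 0`, `r = 1`. A comparison of local sections on charts shows that disjoint jets whose lengths
add up to at most the dimension of the space `S_d` of forms of degree `d` have maximal rank exactly
if their Taylor coefficients are linearly independent functionals on `S_d`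
(`hasMaximalRank_of_jetCoeff_surjective`, `jetCoeff_surjective_of_hasMaximalRank`).

*Sufficiency.* In characteristic zero a generic `r`-jet on a line imposes
`min (r, dim U|_line)` conditions on a space of forms `U`. This is a statement about orders of
vanishing of one-variable polynomials, proved with Wronskians
(`exists_forall_X_sub_C_pow_dvd_imp_eq_zero`). Hence the number of conditions imposed by generic
jets behaves as in Rado's theorem on independent transversals: by induction, the forms vanishing
on given jets form a space of dimension at most
`max_T (dim (forms vanishing on the lines in T) - ∑_{i ∉ T} r i)`
(`exists_forall_finrank_mixedSubspace_le`). So generic jets are independent as soon as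
`dim (forms vanishing on the lines in T) + ∑_{i ∈ T} r i ≤ dim S_d` for each set `T` of lines, which
is `finrank_iInf_ker_add_sum_le`. Away from the plane the lines are skew, and general position says
that they impose `(d + 1) * #T` conditions or lie on no hypersurface of degree `d`. In the plane,
`s ≤ d + 1` distinct lines impose `(d + 1) + d + ⋯ + (d + 2 - s)` conditions, which is the bound in
the numerical condition. Further generic points impose one condition each, and independence is an
open condition on the base points.

*Necessity.* Suitable base points satisfy the given open condition and avoid the other lines, so the
jets are disjoint and their Taylor coefficients are independent. Forms of degree `d` restrict to
polynomials of degree at most `d` on a line, so no jet is longer than `d + 1`. In the plane the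
multiples of a product of `s` linear forms satisfy all conditions of the jets on `s` lines, which
bounds the sum of the lengths of these jets.
-/

open scoped LinearAlgebra.Projectivization

noncomputable section

namespace JetInterpolation

/-! ### Orders of vanishing of one-variable polynomials -/

section Wronskian
variable {k : Type*} [Field k]
open Polynomial

/-- If `W(f, g) = 0`, then `g` is a constant multiple of `f`; here the constant is zero. If `g ≠ 0`,
then in `f * g' = f' * g` the left-hand side has order at `c` one less than that of `g`, and the
right-hand side has at least the order of `g`. -/
theorem eq_zero_of_wronskian_eq_zero [CharZero k] {f g : k[X]} {c : k} (hf : f.eval c ≠ 0)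
    (hg : g.eval c = 0) (h : wronskian f g = 0) : g = 0 := by
  by_contra hg0
  have hf0 : f ≠ 0 := by rintro rfl; simp at hf
  have hroot : g.IsRoot c := hg
  have hpos : 0 < g.rootMultiplicity c := (rootMultiplicity_pos hg0).2 hroot
  have h' : f * derivative g = derivative f * g := sub_eq_zero.1 h
  have hm := derivative_rootMultiplicity_of_root hroot
  have hfm : f.rootMultiplicity c = 0 := rootMultiplicity_eq_zero hf
  have hdg : derivative g ≠ 0 := by
    intro h0
    rw [eq_C_of_natDegree_eq_zero (derivative_eq_zero.1 h0)] at hg hg0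
    simp only [eval_C] at hg
    exact hg0 (by rw [hg, C_0])
  have h1 := congrArg (rootMultiplicity c) h'
  have hne : derivative f * g ≠ 0 := h' ▸ mul_ne_zero hf0 hdg
  rw [rootMultiplicity_mul (mul_ne_zero hf0 hdg), rootMultiplicity_mul hne, hfm, hm] at h1
  omega

/-- In characteristic zero a `v`-dimensional space of polynomials contains, for all but finitely
many `c`, no nonzero polynomial vanishing to order `v` at `c`. By induction: for `f ≠ 0` in the
space, `g ↦ W(f, g)` has one-dimensional kernel and lowers orders of vanishing by at most one. -/
theorem exists_forall_X_sub_C_pow_dvd_imp_eq_zero [CharZero k] (v : ℕ) (U : Submodule k k[X])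
    [FiniteDimensional k U] (hU : Module.finrank k U = v) :
    ∃ b : k[X], b ≠ 0 ∧ ∀ c, b.eval c ≠ 0 → ∀ f ∈ U, (X - C c) ^ v ∣ f → f = 0 := by
  induction v generalizing U with
  | zero =>
    refine ⟨1, one_ne_zero, fun c _ f hf _ => ?_⟩
    rw [Submodule.finrank_eq_zero.1 hU] at hf
    simpa using hf
  | succ v ih =>
    obtain ⟨f, hfU, hf0⟩ : ∃ f ∈ U, f ≠ 0 := by
      refine (Submodule.ne_bot_iff U).1 ?_
      rintro rfl
      simp at hU
    obtain ⟨c₀, hc₀⟩ : ∃ c, f.eval c ≠ 0 := by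
      by_contra! h
      exact hf0 (Polynomial.funext fun c => by simp [h c])
    let W : U →ₗ[k] k[X] := (wronskianBilin k f).comp U.subtype
    have hker : LinearMap.ker W = k ∙ (⟨f, hfU⟩ : U) := by
      refine le_antisymm (fun g hg => ?_) ?_
      · have hg' : wronskian f g.1 = 0 := hg
        refine Submodule.mem_span_singleton.2 ⟨g.1.eval c₀ / f.eval c₀, Subtype.ext ?_⟩
        have h := eq_zero_of_wronskian_eq_zero (f := f)
          (g := g.1 - (g.1.eval c₀ / f.eval c₀) • f) hc₀ (by simp [hc₀]) (by
            rw [← wronskianBilin_apply, map_sub, map_smul, wronskianBilin_apply,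
              wronskianBilin_apply, hg', wronskian_self_eq_zero, smul_zero, sub_zero])
        exact (sub_eq_zero.1 h).symm
      · rw [Submodule.span_singleton_le_iff_mem]
        exact wronskian_self_eq_zero f
    have hrank := W.finrank_range_add_finrank_ker
    rw [hker, finrank_span_singleton (by simpa using hf0), hU, Nat.add_right_cancel_iff] at hrank
    obtain ⟨b, hb0, hb⟩ := ih (LinearMap.range W) hrank
    refine ⟨f * b, mul_ne_zero hf0 hb0, fun c hc g hg hdvd => ?_⟩
    rw [eval_mul] at hc
    have hgc : g.eval c = 0 := by
      rw [← IsRoot.def, ← dvd_iff_isRoot]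
      exact (dvd_pow_self _ v.succ_ne_zero).trans hdvd
    refine eq_zero_of_wronskian_eq_zero (left_ne_zero_of_mul hc) hgc ?_
    have hdvd' : (X - C c) ^ v ∣ wronskian f g :=
      dvd_sub ((pow_sub_one_dvd_derivative_of_pow_dvd hdvd).mul_left f)
        (((pow_dvd_pow _ v.le_succ).trans hdvd).mul_left (derivative f))
    exact hb c (right_ne_zero_of_mul hc) _ (LinearMap.mem_range.2 ⟨⟨g, hg⟩, rfl⟩) hdvd'

end Wronskian

/-! ### Conditions imposed by generic jets on lines -/

section GenericPosition

open Polynomial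

variable {k V : Type*} [Field k] [AddCommGroup V] [Module k V]

theorem finrank_map_add_finrank_inf_ker [FiniteDimensional k V]
    {V' : Type*} [AddCommGroup V'] [Module k V']
    (ρ : V →ₗ[k] V') (Q : Submodule k V) :
    Module.finrank k (Q.map ρ) + Module.finrank k (Q ⊓ LinearMap.ker ρ : Submodule k V) =
      Module.finrank k Q := by
  rw [← (ρ.domRestrict Q).finrank_range_add_finrank_ker, LinearMap.range_domRestrict,
    LinearMap.ker_domRestrict, ← Submodule.finrank_map_subtype_eq Q, Submodule.map_comap_subtype]

/-- The vectors whose image under `ρ` vanishes to order at least `r` at `c`. -/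
def vanishingAt (ρ : V →ₗ[k] k[X]) (c : k) (r : ℕ) : Submodule k V :=
  ((Ideal.span {(X - C c) ^ r}).restrictScalars k).comap ρ

theorem mem_vanishingAt {ρ : V →ₗ[k] k[X]} {c : k} {r : ℕ} {p : V} :
    p ∈ vanishingAt ρ c r ↔ (X - C c) ^ r ∣ ρ p := by
  simp [vanishingAt, Ideal.mem_span_singleton]

theorem ker_le_vanishingAt (ρ : V →ₗ[k] k[X]) (c : k) (r : ℕ) :
    LinearMap.ker ρ ≤ vanishingAt ρ c r := fun p hp => by
  rw [mem_vanishingAt, LinearMap.mem_ker.1 hp]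
  exact dvd_zero _

/-- A generic `r`-jet imposes on a space of sections `U` as many conditions as the dimension of the
restriction of `U` to the line permits. -/
theorem exists_forall_finrank_inf_vanishingAt_le [CharZero k] [FiniteDimensional k V]
    (ρ : V →ₗ[k] k[X])
    (U : Submodule k V) :
    ∃ b : k[X], b ≠ 0 ∧ ∀ c, b.eval c ≠ 0 → ∀ r,
      Module.finrank k (U ⊓ vanishingAt ρ c r : Submodule k V) ≤
        max (Module.finrank k U - r) (Module.finrank k (U ⊓ LinearMap.ker ρ : Submodule k V)) := by
  obtain ⟨b, hb0, hb⟩ := exists_forall_X_sub_C_pow_dvd_imp_eq_zero _ (U.map ρ) rfl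
  refine ⟨b, hb0, fun c hc r => ?_⟩
  set v := Module.finrank k (U.map ρ)
  set Q : Submodule k V := U ⊓ vanishingAt ρ c r
  have hU := finrank_map_add_finrank_inf_ker ρ U
  have hQ := finrank_map_add_finrank_inf_ker ρ Q
  have hker : Q ⊓ LinearMap.ker ρ = U ⊓ LinearMap.ker ρ := by
    rw [inf_assoc, inf_eq_right.2 (ker_le_vanishingAt ρ c r)]
  rw [hker] at hQ
  -- On `ρ(Q)` the first `r` Taylor coefficients at `c` vanish, and the next `v - r` determine an
  -- element.
  let τ : k[X] →ₗ[k] (Fin (v - r) → k) :=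
    LinearMap.pi fun i => (lcoeff k (r + i)).comp (taylor c : k[X] →ₗ[k] k[X])
  have hinj : Function.Injective (τ.domRestrict (Q.map ρ)) := by
    rw [← LinearMap.ker_eq_bot, LinearMap.ker_eq_bot']
    rintro ⟨_, p, hp, rfl⟩ h0
    refine Subtype.ext (hb c hc _ ⟨p, hp.1, rfl⟩ ?_)
    have h1 := mem_vanishingAt.1 hp.2
    rw [X_sub_C_pow_dvd_iff, X_pow_dvd_iff] at h1 ⊢
    intro i hi
    rcases lt_or_ge i r with hir | hir
    · exact h1 i hir
    · have h2 := congrFun h0 ⟨i - r, by omega⟩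
      simpa [τ, Nat.add_sub_cancel' hir, taylor_apply] using h2
  have hle : Module.finrank k (Q.map ρ) ≤ v - r := by
    simpa using LinearMap.finrank_le_finrank_of_injective hinj
  omega

variable {ι : Type*} [DecidableEq ι]

/-- The vectors which vanish to order `r i` at `c i` on the lines in `A`, and identically on the
lines in `B`, where `ρ i` is the restriction to the line with index `i`. -/
def mixedSubspace (ρ : ι → V →ₗ[k] k[X]) (c : ι → k) (r : ι → ℕ) (A B : Finset ι) :
    Submodule k V :=
  (⨅ i ∈ A, vanishingAt (ρ i) (c i) (r i)) ⊓ ⨅ i ∈ B, LinearMap.ker (ρ i)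

theorem mixedSubspace_insert_left (ρ : ι → V →ₗ[k] k[X]) (c : ι → k) (r : ι → ℕ) (A B : Finset ι)
    (a : ι) : mixedSubspace ρ c r (insert a A) B =
      mixedSubspace ρ c r A B ⊓ vanishingAt (ρ a) (c a) (r a) := by
  rw [mixedSubspace, mixedSubspace, Finset.iInf_insert]
  ac_rfl

theorem mixedSubspace_insert_right (ρ : ι → V →ₗ[k] k[X]) (c : ι → k) (r : ι → ℕ)
    (A B : Finset ι) (a : ι) : mixedSubspace ρ c r A (insert a B) =
      mixedSubspace ρ c r A B ⊓ LinearMap.ker (ρ a) := by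
  rw [mixedSubspace, mixedSubspace, Finset.iInf_insert]
  rw [inf_assoc, inf_comm (LinearMap.ker (ρ a))]

theorem mixedSubspace_update (ρ : ι → V →ₗ[k] k[X]) (c : ι → k) (r : ι → ℕ) (A B : Finset ι)
    {a : ι} (ha : a ∉ A) (x : k) :
    mixedSubspace ρ (Function.update c a x) r A B = mixedSubspace ρ c r A B := by
  rw [mixedSubspace, mixedSubspace]
  congr 1
  refine iInf_congr fun i => iInf_congr fun hi => ?_
  rw [Function.update_of_ne (by rintro rfl; exact ha hi)]

/-- The analogue of Rado's theorem for generic jets: the number of conditions that they impose is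
bounded only by what whole lines impose. The induction on the number of jets replaces each jet
either by `r` independent conditions or by its whole line. -/
theorem exists_forall_finrank_mixedSubspace_le [CharZero k] [FiniteDimensional k V]
    [Fintype ι]
    (ρ : ι → V →ₗ[k] k[X]) (r : ι → ℕ) (A : Finset ι) :
    ∃ c : ι → k, ∀ (B : Finset ι) (D : ℕ),
      (∀ T ⊆ A, Module.finrank k (⨅ i ∈ T ∪ B, LinearMap.ker (ρ i) : Submodule k V) ≤
        D + ∑ i ∈ A \ T, r i) →
      Module.finrank k (mixedSubspace ρ c r A B) ≤ D := by
  induction A using Finset.induction_on with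
  | empty =>
    refine ⟨0, fun B D h => ?_⟩
    have h0 := h ∅ subset_rfl
    rwa [Finset.empty_union, Finset.empty_sdiff, Finset.sum_empty, add_zero,
      show (⨅ i ∈ B, LinearMap.ker (ρ i)) = mixedSubspace ρ 0 r ∅ B by simp [mixedSubspace]] at h0
  | insert a A ha ih =>
    obtain ⟨c, hc⟩ := ih
    choose b hb0 hb using fun B =>
      exists_forall_finrank_inf_vanishingAt_le (ρ a) (mixedSubspace ρ c r A B)
    obtain ⟨x, hx⟩ : ∃ x, (∏ B, b B).eval x ≠ 0 := by
      by_contra! h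
      exact Finset.prod_ne_zero_iff.2 (fun B _ => hb0 B) (Polynomial.funext fun x => by
        rw [h x, eval_zero])
    rw [eval_prod, Finset.prod_ne_zero_iff] at hx
    refine ⟨Function.update c a x, fun B D h => ?_⟩
    rw [mixedSubspace_insert_left, mixedSubspace_update _ _ _ _ _ ha, Function.update_self]
    refine (hb B x (hx B (Finset.mem_univ B)) (r a)).trans (max_le ?_ ?_)
    · refine Nat.sub_le_iff_le_add.2 (hc B _ fun T hT => ?_)
      have haT : a ∉ T := fun h => ha (hT h)
      have := h T (hT.trans (Finset.subset_insert _ _))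
      rwa [Finset.insert_sdiff_of_notMem _ haT,
        Finset.sum_insert (fun h => ha (Finset.mem_sdiff.1 h).1), ← add_assoc] at this
    · rw [← mixedSubspace_insert_right]
      refine hc _ D fun T hT => ?_
      have := h (insert a T) (Finset.insert_subset_insert a hT)
      rwa [Finset.insert_union, ← Finset.union_insert, Finset.insert_sdiff_insert,
        Finset.sdiff_insert_of_notMem ha] at this

end GenericPosition

variable {k : Type*} [Field k] {n : ℕ}

/-! ### Restriction of forms to a closed subscheme -/

open MvPolynomial in
/-- Two forms representing a section on the charts of `X i` and `X j` agree in `S / I` after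
clearing denominators and multiplying by a power of `X i * X j`. -/
theorem exists_coord_pow_mul_mem (I : Ideal (CoordRing k n)) {d : ℕ}
    (f : globalSections I d) {i j : Fin (n + 1)} {N M : ℕ} {p q : CoordRing k n}
    (hp : algebraMap _ (Chart I i) (coord I i) ^ N * f.1 i =
      algebraMap _ (Chart I i) (Ideal.Quotient.mk I p))
    (hq : algebraMap _ (Chart I j) (coord I j) ^ M * f.1 j =
      algebraMap _ (Chart I j) (Ideal.Quotient.mk I q)) :
    ∃ K : ℕ, (X i * X j) ^ K * (X j ^ M * p - X i ^ N * q) ∈ I := by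
  have h := f.2.2 i j
  have hp' := congrArg (IsLocalization.Away.awayToAwayRight (P := Overlap I i j)
    (coord I i) (coord I j)) hp
  have hq' := congrArg (IsLocalization.Away.awayToAwayLeft (P := Overlap I i j)
    (coord I j) (coord I i)) hq
  rw [map_mul, map_pow, IsLocalization.Away.awayToAwayRight_eq,
    IsLocalization.Away.awayToAwayRight_eq] at hp'
  rw [map_mul, map_pow, IsLocalization.Away.awayToAwayLeft_eq,
    IsLocalization.Away.awayToAwayLeft_eq, ← h] at hq'
  have key : algebraMap _ (Overlap I i j) (Ideal.Quotient.mk I (X j ^ M * p)) =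
      algebraMap _ (Overlap I i j) (Ideal.Quotient.mk I (X i ^ N * q)) := by
    simp only [map_mul, map_pow, ← hp', ← hq']
    ring
  obtain ⟨K, hK⟩ := IsLocalization.Away.exists_of_eq (coord I i * coord I j) key
  refine ⟨K, ?_⟩
  rw [← Ideal.Quotient.eq_zero_iff_mem]
  simp only [map_mul, map_pow, map_sub] at hK ⊢
  linear_combination hK

theorem restriction_apply (I : Ideal (CoordRing k n)) (d : ℕ)
    (p : MvPolynomial.homogeneousSubmodule (Fin (n + 1)) k d) (i : Fin (n + 1)) :
    (restriction I d p).1 i = algebraMap _ (Chart I i) (Ideal.Quotient.mk I p.1) := rfl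

/-- Let the homogeneous elements of `I` be the common zeros of ring homomorphisms `Φ i`, each of
which inverts some coordinate. If the forms of degree `d` attain all families of values of the
`Φ i`, then they attain all sections of `O_Y(d)`: a section has a value under each `Φ i`, computed
on a chart whose coordinate `Φ i` inverts, and is determined by these values. -/
theorem restriction_surjective_of_forall_exists {ι : Type*} [Finite ι]
    {A : ι → Type*} [∀ i, CommRing (A i)]
    (Φ : ∀ i, CoordRing k n →+* A i) {I : Ideal (CoordRing k n)} {d : ℕ}
    (hI : ∀ (e : ℕ) (p : CoordRing k n), p.IsHomogeneous e → (p ∈ I ↔ ∀ i, Φ i p = 0))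
    (hunit : ∀ i, ∃ l, IsUnit (Φ i (MvPolynomial.X l)))
    (hs : ∀ a : ∀ i, A i, ∃ p : CoordRing k n, p.IsHomogeneous d ∧ ∀ i, Φ i p = a i) :
    Function.Surjective (restriction I d) := by
  cases nonempty_fintype ι
  intro f
  choose N q hq hqf using f.2.1
  choose j hj using hunit
  obtain ⟨p, hp, hpa⟩ := hs fun i => ↑((hj i).unit⁻¹ ^ N (j i)) * Φ i (q (j i))
  have hpa' : ∀ i, Φ i (MvPolynomial.X (j i)) ^ N (j i) * Φ i p = Φ i (q (j i)) := by
    intro i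
    have h : Φ i (MvPolynomial.X (j i)) * ↑((hj i).unit⁻¹) = 1 := (hj i).mul_val_inv
    rw [hpa, ← mul_assoc, Units.val_pow_eq_pow_val, ← mul_pow, h, one_pow, one_mul]
  refine ⟨⟨p, hp⟩, ?_⟩
  ext l
  rw [restriction_apply]
  choose K hK using fun i => exists_coord_pow_mul_mem I f (hqf l) (hqf (j i))
  -- Where `X l` does not vanish, the form `p` agrees with the given section `q l / X l ^ N l`.
  have hmem : (MvPolynomial.X l ^ (∑ i, K i) * (MvPolynomial.X l ^ N l * p - q l) :
      CoordRing k n) ∈ I := by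
    refine (hI ((∑ i, K i) + (d + N l)) _ ?_).2 fun i => ?_
    · refine (MvPolynomial.isHomogeneous_X_pow l _).mul (.sub ?_ (hq l))
      rw [add_comm d]
      exact (MvPolynomial.isHomogeneous_X_pow l _).mul hp
    · have hhom : ((MvPolynomial.X l * MvPolynomial.X (j i)) ^ K i *
          (MvPolynomial.X (j i) ^ N (j i) * q l - MvPolynomial.X l ^ N l * q (j i)) :
          CoordRing k n).IsHomogeneous ((1 + 1) * K i + (N (j i) + N l + d)) := by
        refine (((MvPolynomial.isHomogeneous_X k l).mul
          (MvPolynomial.isHomogeneous_X k (j i))).pow _).mul (.sub ?_ ?_)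
        · have h := (MvPolynomial.isHomogeneous_X_pow (R := k) (j i) (N (j i))).mul (hq l)
          rwa [show N (j i) + (d + N l) = N (j i) + N l + d by omega] at h
        · have h := (MvPolynomial.isHomogeneous_X_pow (R := k) l (N l)).mul (hq (j i))
          rwa [show N l + (d + N (j i)) = N (j i) + N l + d by omega] at h
      have h0 := (hI _ _ hhom).1 (hK i) i
      simp only [map_mul, map_pow, map_sub, ← hpa' i] at h0 ⊢
      have hu := ((hj i).pow (K i)).mul ((hj i).pow (N (j i)))
      have h1 : Φ i (MvPolynomial.X l) ^ K i *
          (Φ i (MvPolynomial.X l) ^ N l * Φ i p - Φ i (q l)) = 0 := by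
        refine hu.mul_right_eq_zero.1 ?_
        linear_combination -h0
      obtain ⟨s, hs⟩ := Nat.exists_eq_add_of_le
        (Finset.single_le_sum (fun i _ => Nat.zero_le (K i)) (Finset.mem_univ i))
      rw [hs, pow_add]
      linear_combination Φ i (MvPolynomial.X l) ^ s * h1
  rw [← Ideal.Quotient.eq_zero_iff_mem] at hmem
  have h2 := congrArg (algebraMap _ (Chart I l)) hmem
  have hl := IsLocalization.Away.algebraMap_isUnit (S := Chart I l) (coord I l)
  simp only [map_mul, map_pow, map_sub, map_zero, ← hqf l] at h2
  rw [(hl.pow _).mul_right_eq_zero, ← mul_sub, (hl.pow _).mul_right_eq_zero] at h2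
  exact sub_eq_zero.1 h2

/-- If restriction to `Y` is surjective in degree `d`, then a family of values of the `Φ i` that
glues, in the sense that after multiplication by a power of each coordinate it comes from a form,
comes from a form of degree `d`. -/
theorem exists_forall_eq_of_restriction_surjective {ι : Type*}
    {A : ι → Type*} [∀ i, CommRing (A i)]
    (Φ : ∀ i, CoordRing k n →+* A i) {I : Ideal (CoordRing k n)} {d : ℕ}
    (hI : ∀ (e : ℕ) (p : CoordRing k n), p.IsHomogeneous e → (p ∈ I ↔ ∀ i, Φ i p = 0))
    (hreg : ∀ i, ∃ l, Φ i (MvPolynomial.X l) ∈ nonZeroDivisors (A i))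
    (hs : Function.Surjective (restriction I d)) (a : ∀ i, A i) (M : ℕ)
    (ha : ∀ l, ∃ p : CoordRing k n, p.IsHomogeneous (d + M) ∧
      ∀ i, Φ i p = Φ i (MvPolynomial.X l) ^ M * a i) :
    ∃ p : CoordRing k n, p.IsHomogeneous d ∧ ∀ i, Φ i p = a i := by
  choose q hq hqa using ha
  choose s hs' using fun l =>
    (IsLocalization.Away.algebraMap_isUnit (S := Chart I l) (coord I l)).exists_right_inv
  let f : ∀ l, Chart I l := fun l => s l ^ M * algebraMap _ _ (Ideal.Quotient.mk I (q l))
  have hf : ∀ l, algebraMap _ (Chart I l) (coord I l) ^ M * f l =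
      algebraMap _ _ (Ideal.Quotient.mk I (q l)) := by
    intro l
    rw [← mul_assoc, ← mul_pow, hs', one_pow, one_mul]
  have hfmem : f ∈ globalSections I d := by
    refine ⟨fun l => ⟨M, q l, hq l, hf l⟩, fun i j => ?_⟩
    have hij : (MvPolynomial.X j ^ M * q i - MvPolynomial.X i ^ M * q j : CoordRing k n) ∈ I := by
      refine (hI (M + (d + M)) _ (.sub ((MvPolynomial.isHomogeneous_X_pow j _).mul (hq i))
        ((MvPolynomial.isHomogeneous_X_pow i _).mul (hq j)))).2 fun l => ?_
      simp only [map_sub, map_mul, map_pow, hqa]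
      ring
    rw [← Ideal.Quotient.eq_zero_iff_mem] at hij
    have h := congrArg (algebraMap _ (Overlap I i j)) hij
    have h1 := congrArg (IsLocalization.Away.awayToAwayRight (P := Overlap I i j)
      (coord I i) (coord I j)) (hf i)
    have h2 := congrArg (IsLocalization.Away.awayToAwayLeft (P := Overlap I i j)
      (coord I j) (coord I i)) (hf j)
    rw [map_mul, map_pow, IsLocalization.Away.awayToAwayRight_eq,
      IsLocalization.Away.awayToAwayRight_eq] at h1
    rw [map_mul, map_pow, IsLocalization.Away.awayToAwayLeft_eq,
      IsLocalization.Away.awayToAwayLeft_eq] at h2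
    have hu := (IsLocalization.Away.algebraMap_isUnit (S := Overlap I i j)
      (coord I i * coord I j)).pow M
    rw [← sub_eq_zero, ← hu.mul_right_eq_zero]
    simp only [map_sub, map_mul, map_pow, map_zero, ← h1, ← h2] at h ⊢
    linear_combination h
  obtain ⟨⟨p, hp⟩, hpf⟩ := hs ⟨f, hfmem⟩
  refine ⟨p, hp, fun i => ?_⟩
  obtain ⟨l, hl⟩ := hreg i
  have h1 := hf l
  have h2 : algebraMap _ (Chart I l) (Ideal.Quotient.mk I p) = f l :=
    congrFun (congrArg Subtype.val hpf) l
  rw [← h2, ← map_pow, ← map_mul, ← map_pow, ← map_mul] at h1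
  obtain ⟨K, hK⟩ := IsLocalization.Away.exists_of_eq (coord I l) h1
  have hmem : (MvPolynomial.X l ^ K * (MvPolynomial.X l ^ M * p - q l) : CoordRing k n) ∈ I := by
    rw [← Ideal.Quotient.eq_zero_iff_mem]
    simp only [map_mul, map_pow, map_sub] at hK ⊢
    linear_combination hK
  have h3 := (hI (K + (d + M)) _ ((MvPolynomial.isHomogeneous_X_pow l _).mul (.sub (by
    rw [add_comm d]; exact (MvPolynomial.isHomogeneous_X_pow l _).mul hp) (hq l)))).1 hmem i
  simp only [map_mul, map_pow, map_sub, hqa, ← mul_sub] at h3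
  rw [← mul_assoc, ← pow_add] at h3
  exact sub_eq_zero.1 ((mul_left_mem_nonZeroDivisors_eq_zero_iff (pow_mem hl _)).1 h3)

theorem mem_of_restriction_eq {I : Ideal (CoordRing k n)} {d : ℕ}
    (h : Function.Injective (restriction I d)) {p : CoordRing k n} (hp : p.IsHomogeneous d)
    (hpI : p ∈ I) : p = 0 := by
  have h0 : (⟨p, hp⟩ : MvPolynomial.homogeneousSubmodule (Fin (n + 1)) k d) = 0 := by
    refine h ?_
    rw [map_zero]
    ext i
    rw [restriction_apply, Ideal.Quotient.eq_zero_iff_mem.2 hpI, map_zero]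
    rfl
  exact congrArg Subtype.val h0

/-! ### Restriction of forms to parametrized lines, and the ideals of lines and jets -/

section LineEval
open Polynomial

/-- Restriction of polynomials to the parametrized affine line `t ↦ v + t • w`. -/
def lineEval (v w : Cone k n) : CoordRing k n →ₐ[k] k[X] :=
  MvPolynomial.aeval fun l => C (v l) + C (w l) * X

theorem lineEval_X (v w : Cone k n) (l : Fin (n + 1)) :
    lineEval v w (MvPolynomial.X l) = C (v l) + C (w l) * X := by
  simp [lineEval]

theorem eval_lineEval (v w : Cone k n) (c : k) (p : CoordRing k n) :
    (lineEval v w p).eval c = MvPolynomial.eval (v + c • w) p := by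
  have h : (aeval c).comp (lineEval v w) = MvPolynomial.aeval (v + c • w) := by
    refine MvPolynomial.algHom_ext fun l => ?_
    rw [AlgHom.comp_apply, lineEval_X, MvPolynomial.aeval_X]
    simp [mul_comm c]
  exact congrArg (fun f => f p) h

theorem coeff_zero_lineEval (v w : Cone k n) (p : CoordRing k n) :
    (lineEval v w p).coeff 0 = MvPolynomial.eval v p := by
  rw [coeff_zero_eq_eval_zero, eval_lineEval, zero_smul, add_zero]

theorem lineEval_add_smul (v w : Cone k n) (c : k) (p : CoordRing k n) :
    lineEval (v + c • w) w p = (lineEval v w p).comp (X + C c) := by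
  have h : lineEval (v + c • w) w = (aeval (X + C c)).comp (lineEval v w) := by
    refine MvPolynomial.algHom_ext fun l => ?_
    simp only [AlgHom.comp_apply, lineEval_X, map_add, map_mul, aeval_C, aeval_X]
    simp
    ring
  rw [h]
  rfl

theorem natDegree_lineEval_le (v w : Cone k n) {e : ℕ} {p : CoordRing k n}
    (hp : p.IsHomogeneous e) : (lineEval v w p).natDegree ≤ e := by
  rw [lineEval, MvPolynomial.aeval_def, MvPolynomial.eval₂_eq]
  refine natDegree_sum_le_of_forall_le _ _ fun m hm => ?_
  have hdeg : m.degree = e :=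
      (DFunLike.congr_fun Finsupp.degree_eq_weight_one m).trans
        (hp (MvPolynomial.mem_support_iff.1 hm))
  refine natDegree_C_mul_le _ _ |>.trans ?_
  refine (natDegree_prod_le _ _).trans ?_
  rw [← hdeg, Finsupp.degree_apply]
  refine Finset.sum_le_sum fun l _ => ?_
  refine natDegree_pow_le.trans ?_
  refine (Nat.mul_le_mul_left _ ?_).trans (mul_one _).le
  compute_degree

theorem lineEval_eq_zero_of_mem_linearIdeal [Infinite k] {L : Submodule k (Cone k n)}
    {v w : Cone k n} (hv : v ∈ L) (hw : w ∈ L) {p : CoordRing k n} (hp : p ∈ linearIdeal L) :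
    lineEval v w p = 0 := by
  refine Polynomial.funext fun c => ?_
  rw [eval_lineEval, eval_zero]
  exact MvPolynomial.mem_vanishingIdeal_iff.1 hp _ (L.add_mem hv (L.smul_mem c hw))

theorem eval_smul_of_isHomogeneous {e : ℕ} {p : CoordRing k n} (hp : p.IsHomogeneous e) (c : k)
    (v : Cone k n) : MvPolynomial.eval (c • v) p = c ^ e * MvPolynomial.eval v p := by
  rw [MvPolynomial.eval_eq, MvPolynomial.eval_eq, Finset.mul_sum]
  refine Finset.sum_congr rfl fun m hm => ?_
  have hdeg : m.degree = e :=
      (DFunLike.congr_fun Finsupp.degree_eq_weight_one m).trans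
        (hp (MvPolynomial.mem_support_iff.1 hm))
  simp only [Pi.smul_apply, smul_eq_mul, mul_pow, Finset.prod_mul_distrib,
    Finset.prod_pow_eq_pow_sum]
  rw [← hdeg, Finsupp.degree_apply]
  ring

/-- A form vanishes on a line if it vanishes on an affine part of it. -/
theorem mem_linearIdeal_iff_lineEval_eq_zero [Infinite k] {L : Submodule k (Cone k n)}
    {v w : Cone k n} (hL : L = Submodule.span k {v, w}) {e : ℕ} {p : CoordRing k n}
    (hp : p.IsHomogeneous e) : p ∈ linearIdeal L ↔ lineEval v w p = 0 := by
  refine ⟨lineEval_eq_zero_of_mem_linearIdeal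
    (hL ▸ Submodule.subset_span (by simp)) (hL ▸ Submodule.subset_span (by simp)), fun h => ?_⟩
  refine MvPolynomial.mem_vanishingIdeal_iff.2 fun x hx => ?_
  rw [SetLike.mem_coe, hL, Submodule.mem_span_pair] at hx
  obtain ⟨a, b, rfl⟩ := hx
  have hne : ∀ a : k, a ≠ 0 → MvPolynomial.eval (b • w + a • v) p = 0 := by
    intro a ha
    rw [show b • w + a • v = a • (v + (a⁻¹ * b) • w) by
      rw [smul_add, smul_smul, mul_inv_cancel_left₀ ha, add_comm],
      eval_smul_of_isHomogeneous hp, ← eval_lineEval, h, eval_zero, mul_zero]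
  -- The remaining case `a = 0` follows since a polynomial in `a` has finitely many zeros.
  have h0 : lineEval (b • w) v p = 0 := by
    have : X * lineEval (b • w) v p = 0 := by
      refine Polynomial.funext fun a => ?_
      rw [eval_mul, eval_X, eval_lineEval, eval_zero, mul_eq_zero]
      exact or_iff_not_imp_left.2 (hne a)
    exact (mul_eq_zero.1 this).resolve_left X_ne_zero
  rw [MvPolynomial.aeval_eq_eval, add_comm (a • v), ← eval_lineEval, h0, eval_zero]

/-- The linear form on the affine cone given by a functional. -/
def linearForm (φ : Module.Dual k (Cone k n)) : CoordRing k n :=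
  ∑ l, MvPolynomial.C (φ (Pi.single l 1)) * MvPolynomial.X l

theorem isHomogeneous_linearForm (φ : Module.Dual k (Cone k n)) :
    (linearForm φ).IsHomogeneous 1 := by
  refine MvPolynomial.IsHomogeneous.sum _ _ _ fun l _ => ?_
  simpa using (MvPolynomial.isHomogeneous_C _ _).mul (MvPolynomial.isHomogeneous_X _ _)

theorem sum_apply_single_mul (φ : Module.Dual k (Cone k n)) (v : Cone k n) :
    ∑ l, φ (Pi.single l 1) * v l = φ v := by
  conv_rhs => rw [pi_eq_sum_univ' v, map_sum]
  refine Finset.sum_congr rfl fun l _ => ?_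
  rw [map_smul, smul_eq_mul, mul_comm]

theorem eval_linearForm (φ : Module.Dual k (Cone k n)) (v : Cone k n) :
    MvPolynomial.eval v (linearForm φ) = φ v := by
  simp [linearForm, sum_apply_single_mul]

theorem lineEval_linearForm (φ : Module.Dual k (Cone k n)) (v w : Cone k n) :
    lineEval v w (linearForm φ) = C (φ v) + C (φ w) * X := by
  rw [← sum_apply_single_mul φ v, ← sum_apply_single_mul φ w, linearForm]
  simp only [map_sum, map_mul, lineEval_X, Finset.sum_mul]
  rw [← Finset.sum_add_distrib]
  refine Finset.sum_congr rfl fun l _ => ?_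
  rw [show lineEval v w (MvPolynomial.C (φ (Pi.single l 1))) = C (φ (Pi.single l 1)) from
    MvPolynomial.aeval_C _ _]
  ring

theorem exists_dual_pair {v w : Cone k n} (h : LinearIndependent k ![v, w]) :
    ∃ η σ : Module.Dual k (Cone k n), η v = 1 ∧ η w = 0 ∧ σ v = 0 ∧ σ w = 1 := by
  obtain ⟨g, hg⟩ := LinearMap.exists_leftInverse_of_injective
    (Fintype.linearCombination k ![v, w])
    (LinearMap.ker_eq_bot.2 h.fintypeLinearCombination_injective)
  have hv : g v = Pi.single 0 1 := by
    simpa using congrArg (fun f => f (Pi.single 0 1)) hg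
  have hw : g w = Pi.single 1 1 := by
    simpa using congrArg (fun f => f (Pi.single 1 1)) hg
  exact ⟨(LinearMap.proj 0).comp g, (LinearMap.proj 1).comp g, by simp [hv], by simp [hw],
    by simp [hv], by simp [hw]⟩

theorem mk_submodule {v : Cone k n} (hv : v ≠ 0) :
    (Projectivization.mk k v hv).submodule = k ∙ v := Projectivization.submodule_mk v hv

theorem mem_linearIdeal_point_iff {v : Cone k n} (hv : v ≠ 0) {e : ℕ} {p : CoordRing k n}
    (hp : p.IsHomogeneous e) :
    p ∈ linearIdeal (Projectivization.mk k v hv).submodule ↔ MvPolynomial.eval v p = 0 := by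
  rw [mk_submodule, linearIdeal, MvPolynomial.mem_vanishingIdeal_iff]
  simp only [MvPolynomial.aeval_eq_eval]
  refine ⟨fun h => h v (Submodule.mem_span_singleton_self v), fun h x hx => ?_⟩
  obtain ⟨c, rfl⟩ := Submodule.mem_span_singleton.1 hx
  rw [eval_smul_of_isHomogeneous hp, h, mul_zero]

/-- Every polynomial of degree at most `e` on the line through `v` with direction `w` is the
restriction of a form of degree `e`, which can be chosen to vanish at `v` to the same order. -/
theorem exists_isHomogeneous_lineEval_eq {v w : Cone k n} (h : LinearIndependent k ![v, w])
    (hv : v ≠ 0) {e : ℕ} {g : k[X]} (hg : g.natDegree ≤ e) {r : ℕ} (hr : X ^ r ∣ g) :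
    ∃ p : CoordRing k n, p.IsHomogeneous e ∧ lineEval v w p = g ∧
      p ∈ linearIdeal (Projectivization.mk k v hv).submodule ^ r := by
  obtain ⟨η, σ, hηv, hηw, hσv, hσw⟩ := exists_dual_pair h
  have hσ : linearForm σ ∈ linearIdeal (Projectivization.mk k v hv).submodule := by
    rw [mem_linearIdeal_point_iff hv (isHomogeneous_linearForm σ), eval_linearForm, hσv]
  refine ⟨∑ i ∈ Finset.range (e + 1),
    MvPolynomial.C (g.coeff i) * (linearForm σ ^ i * linearForm η ^ (e - i)), ?_, ?_, ?_⟩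
  · refine MvPolynomial.IsHomogeneous.sum _ _ _ fun i hi => ?_
    have h1 := (MvPolynomial.isHomogeneous_C (Fin (n + 1)) (g.coeff i)).mul
      (((isHomogeneous_linearForm σ).pow i).mul ((isHomogeneous_linearForm η).pow (e - i)))
    rwa [show 0 + (1 * i + 1 * (e - i)) = e by have := Finset.mem_range.1 hi; omega] at h1
  · conv_rhs => rw [g.as_sum_range' (e + 1) (Nat.lt_succ_of_le hg)]
    rw [map_sum]
    refine Finset.sum_congr rfl fun i _ => ?_
    rw [map_mul, map_mul, map_pow, map_pow, lineEval_linearForm, lineEval_linearForm, hηv, hηw,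
      hσv, hσw, show lineEval v w (MvPolynomial.C (g.coeff i)) = C (g.coeff i) from
      MvPolynomial.aeval_C _ _]
    simp [C_mul_X_pow_eq_monomial]
  · refine Ideal.sum_mem _ fun i _ => ?_
    rcases lt_or_ge i r with hi | hi
    · rw [X_pow_dvd_iff.1 hr i hi, MvPolynomial.C_0, zero_mul]
      exact Ideal.zero_mem _
    · exact Ideal.mul_mem_left _ _ (Ideal.mul_mem_right _ _
        (Ideal.pow_le_pow_right hi (Ideal.pow_mem_pow hσ i)))

/-- The `r`-jet at `v` consists, on forms, of the Taylor coefficients of order less than `r`. A form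
for which they are zero differs by an element of the ideal of the line from a form in the `r`-th
power of the ideal of the point. -/
theorem mem_jetIdeal_iff [Infinite k] {L : Submodule k (Cone k n)} {v w : Cone k n}
    (h : LinearIndependent k ![v, w]) (hL : L = Submodule.span k {v, w}) (hv : v ≠ 0) {e : ℕ}
    {p : CoordRing k n} (hp : p.IsHomogeneous e) (r : ℕ) :
    p ∈ jetIdeal L (Projectivization.mk k v hv) r ↔ X ^ r ∣ lineEval v w p := by
  constructor
  · have hle : jetIdeal L (Projectivization.mk k v hv) r ≤
        (Ideal.span {X ^ r}).comap (lineEval v w).toRingHom := by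
      refine sup_le (fun q hq => ?_) ?_
      · rw [Ideal.mem_comap]
        change lineEval v w q ∈ _
        rw [lineEval_eq_zero_of_mem_linearIdeal (hL ▸ Submodule.subset_span (by simp))
          (hL ▸ Submodule.subset_span (by simp)) hq]
        exact Ideal.zero_mem _
      · rw [← Ideal.span_singleton_pow]
        refine le_trans (Ideal.pow_right_mono (fun q hq => ?_) r) (Ideal.le_comap_pow _ r)
        rw [Ideal.mem_comap, Ideal.mem_span_singleton, X_dvd_iff]
        change (lineEval v w q).coeff 0 = 0
        rw [coeff_zero_lineEval]
        refine MvPolynomial.mem_vanishingIdeal_iff.1 hq v ?_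
        rw [mk_submodule]
        exact Submodule.mem_span_singleton_self v
    intro hmem
    exact Ideal.mem_span_singleton.1 (hle hmem)
  · intro hdvd
    obtain ⟨q, hq, hqp, hqm⟩ := exists_isHomogeneous_lineEval_eq h hv
      (natDegree_lineEval_le v w hp) hdvd
    rw [← sub_add_cancel p q]
    refine Ideal.add_mem _ (Ideal.mem_sup_left ?_) (Ideal.mem_sup_right hqm)
    rw [mem_linearIdeal_iff_lineEval_eq_zero hL (hp.sub hq), map_sub, hqp, sub_self]

end LineEval

/-! ### The dimension of the space of forms -/

instance finiteDimensional_homogeneousSubmodule (d : ℕ) :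
    FiniteDimensional k (MvPolynomial.homogeneousSubmodule (Fin (n + 1)) k d) :=
  Module.Finite.iff_fg.2 (MvPolynomial.homogeneousSubmodule_fg _ _ d)

theorem finrank_homogeneousSubmodule (d : ℕ) :
    Module.finrank k (MvPolynomial.homogeneousSubmodule (Fin (n + 1)) k d) = (n + d).choose d := by
  rw [(LinearEquiv.ofEq _ _
    (MvPolynomial.homogeneousSubmodule_eq_finsupp_supported (Fin (n + 1)) k d)).finrank_eq,
    (AddMonoidAlgebra.supportedEquivFinsupp _).finrank_eq]
  have hset : {m : Fin (n + 1) →₀ ℕ | m.degree = d} =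
      ((Finset.univ : Finset (Fin (n + 1))).finsuppAntidiag d : Set (Fin (n + 1) →₀ ℕ)) := by
    ext m
    simp [Finsupp.degree_eq_sum]
  rw [hset, Module.finrank_finsupp_self]
  simp [Finset.card_finsuppAntidiag_nat_eq_choose]

/-! ### The conditions imposed by lines -/

section Lines
open Polynomial

/-- Restriction of forms of degree `d` to the parametrized affine line `t ↦ v + t • w`. -/
def lineRestriction (d : ℕ) (v w : Cone k n) :
    MvPolynomial.homogeneousSubmodule (Fin (n + 1)) k d →ₗ[k] k[X] :=
  (lineEval v w).toLinearMap.comp (Submodule.subtype _)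

theorem lineRestriction_apply {d : ℕ} (v w : Cone k n)
    (p : MvPolynomial.homogeneousSubmodule (Fin (n + 1)) k d) :
    lineRestriction d v w p = lineEval v w p.1 := rfl

theorem mem_ker_lineRestriction {d : ℕ} (v w : Cone k n)
    (p : MvPolynomial.homogeneousSubmodule (Fin (n + 1)) k d) :
    p ∈ LinearMap.ker (lineRestriction d v w) ↔ lineEval v w p.1 = 0 := Iff.rfl

theorem natDegree_le_of_mem_degreeLT {e : ℕ} {g : k[X]} (hg : g ∈ degreeLT k (e + 1)) :
    g.natDegree ≤ e := by
  rw [degreeLT_succ_eq_degreeLE, mem_degreeLE] at hg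
  exact natDegree_le_of_degree_le hg

theorem exists_dual_eq_of_disjoint {P Q : Submodule k (Cone k n)} (h : Disjoint P Q)
    (φ : Module.Dual k (Cone k n)) :
    ∃ β : Module.Dual k (Cone k n), (∀ x ∈ P, β x = φ x) ∧ ∀ x ∈ Q, β x = 0 := by
  obtain ⟨P', hP, hc⟩ := h.exists_isCompl
  refine ⟨φ.comp (P'.projection Q hc), fun x hx => ?_, fun x hx => ?_⟩
  · rw [LinearMap.comp_apply, Submodule.projection_apply_of_mem_left hc (hP hx)]
  · rw [LinearMap.comp_apply, Submodule.projection_apply_of_mem_right hc hx, map_zero]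

/-- If a union of skew lines has surjective restriction in degree `d`, then forms of degree `d`
can be prescribed independently on the lines: the linear forms equal to `X l` on one line and
vanishing on another glue prescribed forms to a section. -/
theorem exists_lineEval_eq_of_restriction_surjective [Infinite k] {ι : Type*} [Fintype ι]
    [DecidableEq ι] {L : ι → Submodule k (Cone k n)} (hskew : ∀ i j, i ≠ j → Disjoint (L i) (L j))
    {v w : ι → Cone k n} (hli : ∀ i, LinearIndependent k ![v i, w i])
    (hL : ∀ i, L i = Submodule.span k {v i, w i}) {I : Ideal (CoordRing k n)}
    (hI : ∀ p, p ∈ I ↔ ∀ i, p ∈ linearIdeal (L i)) {d : ℕ}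
    (hs : Function.Surjective (restriction I d)) (g : ι → k[X]) (hg : ∀ i, (g i).natDegree ≤ d) :
    ∃ p : CoordRing k n, p.IsHomogeneous d ∧ ∀ i, lineEval (v i) (w i) p = g i := by
  have hv : ∀ i, v i ≠ 0 := fun i => (hli i).ne_zero 0
  choose q hq hqg _ using fun i =>
    exists_isHomogeneous_lineEval_eq (hli i) (hv i) (hg i) (r := 0) (by simp)
  refine exists_forall_eq_of_restriction_surjective (fun i => (lineEval (v i) (w i)).toRingHom)
    (fun e p hp => ?_) (fun i => ?_) hs g (Fintype.card ι - 1) (fun l => ?_)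
  · rw [hI]
    exact forall_congr' fun i => mem_linearIdeal_iff_lineEval_eq_zero (hL i) hp
  · obtain ⟨l, hl⟩ := Function.ne_iff.1 (hv i)
    refine ⟨l, mem_nonZeroDivisors_of_ne_zero fun h => hl ?_⟩
    have := congrArg (eval 0) h
    simpa [lineEval_X] using this
  · have hβ : ∀ i j, ∃ β : Module.Dual k (Cone k n),
        i ≠ j → (∀ x ∈ L i, β x = x l) ∧ ∀ x ∈ L j, β x = 0 := by
      intro i j
      by_cases hij : i = j
      · exact ⟨0, fun h => absurd hij h⟩
      · obtain ⟨β, h⟩ := exists_dual_eq_of_disjoint (hskew i j hij) (LinearMap.proj l)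
        exact ⟨β, fun _ => h⟩
    choose β hβ using hβ
    have hvL : ∀ i, v i ∈ L i := fun i => hL i ▸ Submodule.subset_span (by simp)
    have hwL : ∀ i, w i ∈ L i := fun i => hL i ▸ Submodule.subset_span (by simp)
    refine ⟨∑ i, (∏ j ∈ Finset.univ.erase i, linearForm (β i j)) * q i, ?_, fun i => ?_⟩
    · refine MvPolynomial.IsHomogeneous.sum _ _ _ fun i _ => ?_
      have h1 := MvPolynomial.IsHomogeneous.prod (Finset.univ.erase i)
        (fun j => linearForm (β i j)) (fun _ => 1) fun j _ => isHomogeneous_linearForm (β i j)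
      have h2 := h1.mul (hq i)
      rwa [Finset.sum_const, smul_eq_mul, mul_one, Finset.card_erase_of_mem (Finset.mem_univ i),
        Finset.card_univ, add_comm _ d] at h2
    · change lineEval (v i) (w i) _ = lineEval (v i) (w i) _ ^ _ * _
      rw [map_sum, Finset.sum_eq_single i]
      · rw [map_mul, map_prod, hqg, Finset.prod_congr rfl (g := fun _ => lineEval (v i) (w i)
          (MvPolynomial.X l)), Finset.prod_const, Finset.card_erase_of_mem (Finset.mem_univ i),
          Finset.card_univ]
        intro j hj
        have h := (hβ i j (Finset.ne_of_mem_erase hj).symm).1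
        rw [lineEval_linearForm, lineEval_X, h _ (hvL i), h _ (hwL i)]
      · intro j _ hji
        rw [map_mul, map_prod, Finset.prod_eq_zero (i := i), zero_mul]
        · exact Finset.mem_erase.2 ⟨hji.symm, Finset.mem_univ i⟩
        · have h := (hβ j i hji).2
          rw [lineEval_linearForm, h _ (hvL i), h _ (hwL i)]
          simp
      · simp

/-- Skew lines whose union has maximal rank in degree `d` impose independent conditions on forms of
degree `d`, or else lie on no hypersurface of degree `d`. -/
theorem finrank_iInf_ker_of_disjoint [Infinite k] {ι : Type*} [DecidableEq ι]
    {L : ι → Submodule k (Cone k n)} (hskew : ∀ i j, i ≠ j → Disjoint (L i) (L j))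
    {v w : ι → Cone k n} (hli : ∀ i, LinearIndependent k ![v i, w i])
    (hL : ∀ i, L i = Submodule.span k {v i, w i}) {d : ℕ} {T : Finset ι}
    (hT : HasMaximalRank (⨅ i ∈ T, linearIdeal (L i)) d) :
    Module.finrank k (⨅ i ∈ T, LinearMap.ker (lineRestriction d (v i) (w i)) :
        Submodule k (MvPolynomial.homogeneousSubmodule (Fin (n + 1)) k d)) = 0 ∨
      Module.finrank k (⨅ i ∈ T, LinearMap.ker (lineRestriction d (v i) (w i)) :
        Submodule k (MvPolynomial.homogeneousSubmodule (Fin (n + 1)) k d)) + T.card * (d + 1) =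
          (n + d).choose d := by
  rcases hT with hinj | hsurj
  · left
    rw [Submodule.finrank_eq_zero, eq_bot_iff]
    intro p hp
    refine Subtype.ext (mem_of_restriction_eq hinj p.2 ?_)
    simp only [Submodule.mem_iInf, mem_ker_lineRestriction] at hp ⊢
    exact fun i hi => (mem_linearIdeal_iff_lineEval_eq_zero (hL i) p.2).2 (hp i hi)
  · right
    let τ : MvPolynomial.homogeneousSubmodule (Fin (n + 1)) k d →ₗ[k] (T → Fin (d + 1) → k) :=
      LinearMap.pi fun i => LinearMap.pi fun a => (lcoeff k a).comp (lineRestriction d (v i) (w i))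
    have hτ : Function.Surjective τ := by
      intro y
      obtain ⟨p, hp, hpy⟩ := exists_lineEval_eq_of_restriction_surjective
        (L := fun i : T => L i) (v := fun i : T => v i) (w := fun i : T => w i)
        (fun i j hij => hskew i j fun h => hij (Subtype.ext h)) (fun i => hli i) (fun i => hL i)
        (I := ⨅ i ∈ T, linearIdeal (L i)) (fun p => by simp [Submodule.mem_iInf]) hsurj
        (fun i => ((degreeLTEquiv k (d + 1)).symm (y i)).1) (fun i => by
          exact natDegree_le_of_mem_degreeLT ((degreeLTEquiv k (d + 1)).symm (y i)).2)
      refine ⟨⟨p, hp⟩, funext fun i => ?_⟩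
      have h := (degreeLTEquiv k (d + 1)).apply_symm_apply (y i)
      rw [← h]
      ext a
      change (lineEval (v i) (w i) p).coeff a = _
      rw [hpy]
      rfl
    have hker : LinearMap.ker τ = ⨅ i ∈ T, LinearMap.ker (lineRestriction d (v i) (w i)) := by
      ext p
      simp only [Submodule.mem_iInf, LinearMap.mem_ker]
      refine ⟨fun h i hi => ?_, fun h => ?_⟩
      · ext a
        rcases lt_or_ge a (d + 1) with ha | ha
        · exact congrFun (congrFun h ⟨i, hi⟩) ⟨a, ha⟩
        · rw [coeff_zero, lineRestriction_apply]
          exact coeff_eq_zero_of_natDegree_lt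
            ((natDegree_lineEval_le _ _ p.2).trans_lt (Nat.lt_of_succ_le ha))
      · ext i a
        change (lineRestriction d (v i) (w i) p).coeff a = 0
        rw [h i i.2, coeff_zero]
    have h := τ.finrank_range_add_finrank_ker
    rw [LinearMap.range_eq_top.2 hτ, finrank_top, hker, finrank_homogeneousSubmodule,
      Module.finrank_pi_fintype] at h
    simp only [Module.finrank_fin_fun, Finset.sum_const, Finset.card_univ, Fintype.card_coe,
      smul_eq_mul] at h
    omega

/-- A further line imposes at least `d + 1 - s` conditions on the forms of degree `d` vanishing on
`s` given lines, because of the products of `s` linear forms with arbitrary forms of degree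
`d - s`. -/
theorem finrank_iInf_ker_insert_le {ι : Type*} [DecidableEq ι]
    {v w : ι → Cone k n} (hli : ∀ i, LinearIndependent k ![v i, w i])
    {T : Finset ι} {a : ι} {d : ℕ} (hT : T.card ≤ d)
    (hβ : ∀ i ∈ T, ∃ β : Module.Dual k (Cone k n), β (v i) = 0 ∧ β (w i) = 0 ∧
      (β (v a) ≠ 0 ∨ β (w a) ≠ 0)) :
    Module.finrank k (⨅ i ∈ insert a T, LinearMap.ker (lineRestriction d (v i) (w i)) :
        Submodule k (MvPolynomial.homogeneousSubmodule (Fin (n + 1)) k d)) + (d + 1 - T.card) ≤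
      Module.finrank k (⨅ i ∈ T, LinearMap.ker (lineRestriction d (v i) (w i)) :
        Submodule k (MvPolynomial.homogeneousSubmodule (Fin (n + 1)) k d)) := by
  choose! β hβv hβw hβa using hβ
  set K : Submodule k (MvPolynomial.homogeneousSubmodule (Fin (n + 1)) k d) :=
    ⨅ i ∈ T, LinearMap.ker (lineRestriction d (v i) (w i))
  set ρ := lineRestriction d (v a) (w a)
  rw [Finset.iInf_insert, inf_comm, ← finrank_map_add_finrank_inf_ker ρ K, add_comm]
  refine Nat.add_le_add_right ?_ _
  set f : k[X] := lineEval (v a) (w a) (∏ i ∈ T, linearForm (β i)) with hf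
  have hf0 : f ≠ 0 := by
    rw [hf, map_prod, Finset.prod_ne_zero_iff]
    intro i hi h0
    rw [lineEval_linearForm] at h0
    rcases hβa i hi with h | h
    · exact h (by simpa using congrArg (coeff · 0) h0)
    · exact h (by simpa using congrArg (coeff · 1) h0)
  have hinj : Function.Injective (LinearMap.mulLeft k f) := by
    intro x y hxy
    exact mul_left_cancel₀ hf0 hxy
  have hle : (degreeLT k (d + 1 - T.card)).map (LinearMap.mulLeft k f) ≤ K.map ρ := by
    rintro _ ⟨g, hg, rfl⟩
    have hg' : g.natDegree ≤ d - T.card := by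
      rw [SetLike.mem_coe, Nat.sub_add_comm hT] at hg
      exact natDegree_le_of_mem_degreeLT hg
    obtain ⟨q, hq, hqg, -⟩ := exists_isHomogeneous_lineEval_eq (hli a) ((hli a).ne_zero 0) hg'
      (r := 0) (by simp)
    have hhom := (MvPolynomial.IsHomogeneous.prod T (fun i => linearForm (β i)) (fun _ => 1)
      fun i _ => isHomogeneous_linearForm (β i)).mul hq
    rw [Finset.sum_const, smul_eq_mul, mul_one, Nat.add_sub_cancel' hT] at hhom
    refine ⟨⟨_, hhom⟩, ?_, ?_⟩
    · simp only [K, SetLike.mem_coe, Submodule.mem_iInf, mem_ker_lineRestriction]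
      intro i hi
      rw [map_mul, map_prod, Finset.prod_eq_zero hi, zero_mul]
      rw [lineEval_linearForm, hβv i hi, hβw i hi]
      simp
    · rw [lineRestriction_apply, map_mul, hqg]
      rfl
  have hcard : Module.finrank k ((degreeLT k (d + 1 - T.card)).map (LinearMap.mulLeft k f)) =
      d + 1 - T.card := by
    rw [← (Submodule.equivMapOfInjective _ hinj _).finrank_eq,
      (degreeLTEquiv k (d + 1 - T.card)).finrank_eq, Module.finrank_fin_fun]
  rw [← hcard]
  exact Submodule.finrank_mono hle

/-- On the forms of degree `d`, a set of `s ≤ d + 1` distinct lines imposes at least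
`(d + 1) + d + ⋯ + (d + 2 - s)` conditions. -/
theorem finrank_iInf_ker_add_le {ι : Type*} [DecidableEq ι]
    {v w : ι → Cone k n} (hli : ∀ i, LinearIndependent k ![v i, w i])
    (hβ : ∀ i a, i ≠ a → ∃ β : Module.Dual k (Cone k n), β (v i) = 0 ∧ β (w i) = 0 ∧
      (β (v a) ≠ 0 ∨ β (w a) ≠ 0)) {d : ℕ} (T : Finset ι) (hT : T.card ≤ d + 1) :
    Module.finrank k (⨅ i ∈ T, LinearMap.ker (lineRestriction d (v i) (w i)) :
        Submodule k (MvPolynomial.homogeneousSubmodule (Fin (n + 1)) k d)) + T.card * (d + 1) ≤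
      (n + d).choose d + T.card.choose 2 := by
  induction T using Finset.induction_on with
  | empty =>
    rw [← finrank_homogeneousSubmodule (k := k) (n := n) d]
    simpa using Submodule.finrank_le (⨅ i ∈ (∅ : Finset ι),
      LinearMap.ker (lineRestriction d (v i) (w i)))
  | insert a T ha ih =>
    rw [Finset.card_insert_of_notMem ha] at hT ⊢
    have h1 := ih (by omega)
    have h2 := finrank_iInf_ker_insert_le hli (T := T) (a := a) (d := d) (by omega)
      fun i hi => hβ i a fun h => ha (h ▸ hi)
    have h3 : (T.card + 1).choose 2 = T.card + T.card.choose 2 := by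
      rw [Nat.choose_succ_succ' T.card 1, Nat.choose_one_right]
    rw [h3, add_mul]
    omega

end Lines

/-! ### The conditions imposed by lines in general position -/

section Numerics

/-- The largest sums of a given number of terms are the initial ones. -/
theorem sum_le_sum_filter_lt {m : ℕ} {r : Fin m → ℕ} (hr : Antitone r) (T : Finset (Fin m)) :
    ∑ i ∈ T, r i ≤ ∑ i : Fin m with i.val < T.card, r i := by
  rcases T.eq_empty_or_nonempty with rfl | hT
  · simp
  have hpos := hT.card_pos
  have hm : T.card ≤ m := by simpa using T.card_le_univ
  set P : Finset (Fin m) := Finset.univ.filter fun i => i.val < T.card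
  have hP : P.card = T.card := by
    rw [Fin.card_filter_val_lt, min_eq_right hm]
  have hcard : (T \ P).card = (P \ T).card := Finset.card_sdiff_comm hP.symm
  set c : ℕ := r ⟨T.card - 1, by omega⟩
  have h1 : ∑ i ∈ T \ P, r i ≤ (T \ P).card • c := by
    refine Finset.sum_le_card_nsmul _ _ _ fun i hi => hr ?_
    have := (Finset.mem_sdiff.1 hi).2
    simp only [P, Finset.mem_filter, Finset.mem_univ, true_and, not_lt] at this
    exact Fin.le_def.2 (by change T.card - 1 ≤ _; omega)
  have h2 : (P \ T).card • c ≤ ∑ i ∈ P \ T, r i := by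
    refine Finset.card_nsmul_le_sum _ _ _ fun i hi => hr ?_
    have := (Finset.mem_sdiff.1 hi).1
    simp only [P, Finset.mem_filter, Finset.mem_univ, true_and] at this
    exact Fin.le_def.2 (by change _ ≤ T.card - 1; omega)
  rw [← Finset.sum_inter_add_sum_sdiff T P, ← Finset.sum_inter_add_sum_sdiff P T,
    Finset.inter_comm P T]
  rw [hcard] at h1
  exact Nat.add_le_add_left (h1.trans h2) _

theorem two_mul_choose_two (t : ℕ) : 2 * (t.choose 2 : ℤ) = t * (t - 1) := by
  induction t with
  | zero => simp
  | succ t ih =>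
    rw [Nat.choose_succ_succ' t 1, Nat.choose_one_right]
    push_cast
    linarith

theorem two_add_choose (d : ℕ) : (2 + d).choose d = (d + 2).choose 2 := by
  rw [add_comm, Nat.choose_symm_add]

end Numerics

/-- One of two distinct lines is not contained in some hyperplane through the other. -/
theorem exists_dual_of_ne {P Q : Submodule k (Cone k n)} (hP : Module.finrank k P = 2)
    (hQ : Module.finrank k Q = 2) (h : P ≠ Q) :
    ∃ β : Module.Dual k (Cone k n), (∀ x ∈ P, β x = 0) ∧ ∃ x ∈ Q, β x ≠ 0 := by
  have hle : ¬ Q ≤ P := fun hle => h (Submodule.eq_of_le_of_finrank_eq hle (hQ.trans hP.symm)).symm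
  obtain ⟨x, hxQ, hxP⟩ := SetLike.not_le_iff_exists.1 hle
  obtain ⟨β, hβx, hβ⟩ := Submodule.exists_le_ker_of_notMem hxP
  exact ⟨β, fun y hy => hβ hy, x, hxQ, hβx⟩

theorem InGeneralPosition.disjoint {m : ℕ} {L : Fin m → Submodule k (Cone k n)}
    (hL : InGeneralPosition L) (hn : n ≠ 2) {i j : Fin m} (hij : i ≠ j) :
    Disjoint (L i) (L j) := by
  rcases Nat.lt_or_ge n 3 with h | h
  · have htop : ∀ i, L i = ⊤ := fun i => by
      refine Submodule.eq_top_of_finrank_eq (le_antisymm (Submodule.finrank_le _) ?_)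
      rw [hL.isLine, Module.finrank_fin_fun]
      omega
    exact absurd (hL.distinct ((htop i).trans (htop j).symm)) hij
  · exact hL.skew h i j hij

/-- The hypothesis of Rado's theorem: under the numerical condition, the lines in `T` impose at
least as many conditions on forms of degree `d` as the lengths of the jets on them require. -/
theorem finrank_iInf_ker_add_sum_le [Infinite k] {m : ℕ} {L : Fin m → Submodule k (Cone k n)}
    (hL : InGeneralPosition L) {v w : Fin m → Cone k n}
    (hli : ∀ i, LinearIndependent k ![v i, w i])
    (hspan : ∀ i, L i = Submodule.span k {v i, w i}) {r : Fin m → ℕ} (hr : Antitone r) {d : ℕ}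
    (hsum : ∑ i, r i ≤ (n + d).choose d) (hC : NumericalCondition n d r) (T : Finset (Fin m)) :
    Module.finrank k (⨅ i ∈ T, LinearMap.ker (lineRestriction d (v i) (w i)) :
        Submodule k (MvPolynomial.homogeneousSubmodule (Fin (n + 1)) k d)) + ∑ i ∈ T, r i ≤
      (n + d).choose d := by
  have hT : ∑ i ∈ T, r i ≤ (n + d).choose d :=
    (Finset.sum_le_sum_of_subset (Finset.subset_univ T)).trans hsum
  by_cases hn : n = 2
  · subst hn
    have hβ : ∀ i a, i ≠ a → ∃ β : Module.Dual k (Cone k 2), β (v i) = 0 ∧ β (w i) = 0 ∧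
        (β (v a) ≠ 0 ∨ β (w a) ≠ 0) := by
      intro i a hia
      obtain ⟨β, hβ, x, hx, hβx⟩ := exists_dual_of_ne (hL.isLine i) (hL.isLine a)
        (hL.distinct.ne hia)
      refine ⟨β, hβ _ (hspan i ▸ Submodule.subset_span (by simp)),
        hβ _ (hspan i ▸ Submodule.subset_span (by simp)), ?_⟩
      by_contra! h
      rw [hspan a, Submodule.mem_span_pair] at hx
      obtain ⟨b, c, rfl⟩ := hx
      exact hβx (by simp [h])
    have hN := two_mul_choose_two (d + 2)
    rcases Nat.lt_or_ge (d + 1) T.card with hcard | hcard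
    · -- More than `d + 1` lines lie on no curve of degree `d`.
      obtain ⟨T', hT', hcard'⟩ := Finset.exists_subset_card_eq hcard.le
      have h1 := finrank_iInf_ker_add_le hli hβ (d := d) T' hcard'.le
      have h2 := Submodule.finrank_mono (biInf_mono (f := fun i =>
        LinearMap.ker (lineRestriction d (v i) (w i))) fun i (hi : i ∈ T') => hT' hi)
      have h3 := two_mul_choose_two (d + 1)
      rw [hcard', two_add_choose] at h1
      zify at h1 h2 hT ⊢
      push_cast at h3 hN
      nlinarith
    · have h1 := finrank_iInf_ker_add_le hli hβ (d := d) T hcard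
      rcases Nat.eq_zero_or_pos T.card with h0 | hpos
      · rw [Finset.card_eq_zero.1 h0] at h1 ⊢
        simpa using h1
      · have h2 : ∑ i ∈ T, (r i : ℤ) ≤ ∑ i : Fin m with i.val < T.card, (r i : ℤ) :=
          mod_cast sum_le_sum_filter_lt hr T
        have h3 := hC.2 rfl T.card hpos hcard
        have h4 := two_mul_choose_two T.card
        have h5 := two_mul_choose_two (T.card - 1)
        zify [hpos] at h1 h5 ⊢
        nlinarith
  · rcases finrank_iInf_ker_of_disjoint (fun i j => hL.disjoint hn) hli hspan
      (hL.maximalRank T d) with h | h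
    · rw [h, zero_add]
      exact hT
    · rw [← h]
      refine Nat.add_le_add_left ((Finset.sum_le_card_nsmul T r (d + 1) fun i _ => ?_).trans ?_) _
      · exact (hr (Fin.le_def.2 (Nat.zero_le _))).trans (hC.1 i.pos)
      · rw [smul_eq_mul]

/-! ### Taylor coefficients of forms along lines -/

section JetCoefficients
open Polynomial

/-- The Taylor coefficients of order less than `r i` at `v i` of forms of degree `d`, along the
parametrized lines `t ↦ v i + t • w i`. A reduced point is the case `w i = 0`, `r i = 1`. -/
def jetCoeff {ι : Type*} (d : ℕ) (v w : ι → Cone k n) (r : ι → ℕ) :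
    MvPolynomial.homogeneousSubmodule (Fin (n + 1)) k d →ₗ[k] ((Σ i, Fin (r i)) → k) :=
  LinearMap.pi fun x => (lcoeff k x.2).comp (lineRestriction d (v x.1) (w x.1))

theorem jetCoeff_apply {ι : Type*} {d : ℕ} (v w : ι → Cone k n) (r : ι → ℕ)
    (p : MvPolynomial.homogeneousSubmodule (Fin (n + 1)) k d) (x : Σ i, Fin (r i)) :
    jetCoeff d v w r p x = (lineEval (v x.1) (w x.1) p.1).coeff x.2 := rfl

theorem isUnit_mk_of_coeff_zero_ne_zero {f : k[X]} (hf : f.coeff 0 ≠ 0) (r : ℕ) :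
    IsUnit (Ideal.Quotient.mk (Ideal.span {X ^ r}) f) := by
  have h1 : IsCoprime f X := by
    refine ⟨C (f.coeff 0)⁻¹, -(C (f.coeff 0)⁻¹ * f.divX), ?_⟩
    conv_lhs => enter [1, 2]; rw [← divX_mul_X_add f]
    have h2 : C (f.coeff 0)⁻¹ * C (f.coeff 0) = 1 := by
      rw [← C_mul, inv_mul_cancel₀ hf, C_1]
    linear_combination h2
  obtain ⟨a, b, hab⟩ := h1.pow_right (n := r)
  refine IsUnit.of_mul_eq_one (Ideal.Quotient.mk _ a) ?_
  rw [← map_mul, ← map_one (Ideal.Quotient.mk _), Ideal.Quotient.eq, Ideal.mem_span_singleton]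
  exact ⟨-b, by linear_combination hab⟩

/-- Restriction to the jet `v i + t • w i` modulo `t ^ r i`. -/
def jetEval (v w : Cone k n) (r : ℕ) :
    CoordRing k n →+* k[X] ⧸ (Ideal.span {X ^ r} : Ideal k[X]) :=
  (Ideal.Quotient.mk _).comp (lineEval v w).toRingHom

theorem jetEval_apply (v w : Cone k n) (r : ℕ) (p : CoordRing k n) :
    jetEval v w r p = Ideal.Quotient.mk _ (lineEval v w p) := rfl

theorem jetEval_eq_zero_iff (v w : Cone k n) (r : ℕ) (p : CoordRing k n) :
    jetEval v w r p = 0 ↔ X ^ r ∣ lineEval v w p := by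
  rw [jetEval_apply, Ideal.Quotient.eq_zero_iff_mem, Ideal.mem_span_singleton]

theorem exists_isUnit_jetEval_X {v : Cone k n} (hv : v ≠ 0) (w : Cone k n) (r : ℕ) :
    ∃ l, IsUnit (jetEval v w r (MvPolynomial.X l)) := by
  obtain ⟨l, hl⟩ := Function.ne_iff.1 hv
  refine ⟨l, isUnit_mk_of_coeff_zero_ne_zero ?_ r⟩
  simpa [lineEval_X] using hl

theorem jetEval_eq_mk_iff (v w : Cone k n) (r : ℕ) (p : CoordRing k n) (g : k[X]) :
    jetEval v w r p = Ideal.Quotient.mk _ g ↔ ∀ a < r, (lineEval v w p).coeff a = g.coeff a := by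
  rw [jetEval_apply, Ideal.Quotient.eq, Ideal.mem_span_singleton, X_pow_dvd_iff]
  simp only [coeff_sub, sub_eq_zero]

/-- Jets and points that impose independent conditions on forms of degree `d` have surjective
restriction in degree `d`. -/
theorem hasMaximalRank_of_jetCoeff_surjective {ι : Type*} [Finite ι] {d : ℕ} {v w : ι → Cone k n}
    {r : ι → ℕ} (hv : ∀ i, v i ≠ 0) {I : Ideal (CoordRing k n)}
    (hI : ∀ (e : ℕ) (p : CoordRing k n), p.IsHomogeneous e →
      (p ∈ I ↔ ∀ i, X ^ r i ∣ lineEval (v i) (w i) p))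
    (hs : Function.Surjective (jetCoeff d v w r)) : HasMaximalRank I d := by
  refine Or.inr (restriction_surjective_of_forall_exists (fun i => jetEval (v i) (w i) (r i))
    (fun e p hp => ?_) (fun i => exists_isUnit_jetEval_X (hv i) _ _) fun a => ?_)
  · rw [hI e p hp]
    exact forall_congr' fun i => (jetEval_eq_zero_iff _ _ _ _).symm
  · choose g hg using fun i => Ideal.Quotient.mk_surjective (a i)
    obtain ⟨p, hp⟩ := hs fun x => (g x.1).coeff x.2
    refine ⟨p.1, p.2, fun i => ?_⟩
    rw [← hg, jetEval_eq_mk_iff]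
    exact fun b hb => congrFun hp ⟨i, b, hb⟩

/-- The Taylor coefficients of a form are polynomial functions of the base point. -/
theorem exists_eval_eq_coeff_lineEval {ι : Type*} (i : ι) (w : Cone k n) (p : CoordRing k n)
    (a : ℕ) : ∃ G : MvPolynomial (ι × Fin (n + 1)) k, ∀ v : ι → Cone k n,
      MvPolynomial.eval (fun b => v b.1 b.2) G = (lineEval (v i) w p).coeff a := by
  let ψ : CoordRing k n →ₐ[k] (MvPolynomial (ι × Fin (n + 1)) k)[X] :=
    MvPolynomial.aeval fun l => C (MvPolynomial.X (i, l)) + C (MvPolynomial.C (w l)) * X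
  refine ⟨(ψ p).coeff a, fun v => ?_⟩
  have h : (mapAlgHom (MvPolynomial.aeval (R := k) fun b : ι × Fin (n + 1) => v b.1 b.2)).comp ψ =
      lineEval (v i) w := by
    refine MvPolynomial.algHom_ext fun l => ?_
    simp [ψ, lineEval_X]
  rw [← h, AlgHom.comp_apply, coe_mapAlgHom, coeff_map]
  rfl

/-- Independence of jets is an open condition on their base points: a minor of the matrix of Taylor
coefficients does not vanish. -/
theorem exists_forall_jetCoeff_surjective {ι : Type*} [Fintype ι] [DecidableEq ι] {d : ℕ}
    {v₀ w : ι → Cone k n} {r : ι → ℕ} (hs : Function.Surjective (jetCoeff d v₀ w r)) :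
    ∃ G : MvPolynomial (ι × Fin (n + 1)) k, MvPolynomial.eval (fun b => v₀ b.1 b.2) G ≠ 0 ∧
      ∀ v : ι → Cone k n, MvPolynomial.eval (fun b => v b.1 b.2) G ≠ 0 →
        Function.Surjective (jetCoeff d v w r) := by
  choose p hp using fun x => hs (Pi.single x 1)
  choose E hE using fun x y : Σ i, Fin (r i) =>
    exists_eval_eq_coeff_lineEval x.1 (w x.1) (p y).1 x.2
  have hdet : ∀ v : ι → Cone k n, MvPolynomial.eval (fun b => v b.1 b.2) (Matrix.of E).det =
      (Matrix.of fun x y => jetCoeff d v w r (p y) x).det := by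
    intro v
    rw [RingHom.map_det]
    congr 1
    ext x y
    exact hE x y v
  refine ⟨(Matrix.of E).det, ?_, fun v hv y => ?_⟩
  · have h1 : (Matrix.of fun x y => jetCoeff d v₀ w r (p y) x) = 1 := by
      ext x y
      simp [hp, Matrix.one_apply, Pi.single_apply]
    rw [hdet, h1, Matrix.det_one]
    exact one_ne_zero
  · rw [hdet] at hv
    set M : Matrix (Σ i, Fin (r i)) (Σ i, Fin (r i)) k :=
      Matrix.of fun x y => jetCoeff d v w r (p y) x
    refine ⟨∑ z, (M⁻¹.mulVec y) z • p z, ?_⟩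
    have h2 : M.mulVec (M⁻¹.mulVec y) = y := by
      rw [Matrix.mulVec_mulVec, Matrix.mul_nonsing_inv _ (isUnit_iff_ne_zero.2 hv),
        Matrix.one_mulVec]
    rw [map_sum]
    conv_rhs => rw [← h2]
    ext x
    simp [M, Matrix.mulVec, dotProduct, mul_comm]

/-- Generic points impose independent conditions on a space of forms. -/
theorem exists_finrank_inf_iInf_ker_le [Infinite k] {d : ℕ} (χ D : ℕ)
    (U : Submodule k (MvPolynomial.homogeneousSubmodule (Fin (n + 1)) k d))
    (hU : Module.finrank k U ≤ D + χ) :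
    ∃ y : Fin χ → Cone k n, (∀ j, y j ≠ 0) ∧ Module.finrank k (U ⊓ ⨅ j, LinearMap.ker
      ((lcoeff k 0).comp (lineRestriction d (y j) 0)) : Submodule k _) ≤ D := by
  induction χ generalizing U with
  | zero =>
    refine ⟨Fin.elim0, fun j => j.elim0, ?_⟩
    rwa [iInf_of_empty, inf_top_eq]
  | succ χ ih =>
    obtain ⟨x, hx0, hx⟩ : ∃ x : Cone k n, x ≠ 0 ∧ Module.finrank k
        (U ⊓ LinearMap.ker ((lcoeff k 0).comp (lineRestriction d x 0)) : Submodule k _) ≤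
          D + χ := by
      rcases eq_or_ne U ⊥ with rfl | hne
      · refine ⟨fun _ => 1, Function.ne_iff.2 ⟨0, one_ne_zero⟩, ?_⟩
        rw [bot_inf_eq, finrank_bot]
        exact Nat.zero_le _
      · obtain ⟨p, hpU, hp0⟩ := (Submodule.ne_bot_iff U).1 hne
        obtain ⟨x, hx⟩ : ∃ x, MvPolynomial.eval x (MvPolynomial.X 0 * p.1) ≠ 0 := by
          by_contra! h
          exact mul_ne_zero (MvPolynomial.X_ne_zero 0) (fun h0 => hp0 (Subtype.ext h0))
            (MvPolynomial.funext fun x => by rw [h x, map_zero])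
        rw [map_mul, MvPolynomial.eval_X] at hx
        refine ⟨x, fun h => left_ne_zero_of_mul hx (by rw [h]; rfl), Nat.lt_succ_iff.1
          (lt_of_lt_of_le (Submodule.finrank_lt_finrank_of_lt ?_) hU)⟩
        refine inf_le_left.lt_of_ne fun h => right_ne_zero_of_mul hx ?_
        rw [← h] at hpU
        rw [← coeff_zero_lineEval x 0]
        exact hpU.2
    obtain ⟨y, hy0, hy⟩ := ih _ hx
    refine ⟨Fin.cons x y, Fin.cases hx0 hy0, (Submodule.finrank_mono ?_).trans hy⟩
    refine le_inf (le_inf inf_le_left ?_) ?_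
    · exact inf_le_right.trans (iInf_le _ 0)
    · exact inf_le_right.trans (le_iInf fun j => iInf_le _ j.succ)

/-- Under the numerical condition some jets on the lines, based at `v i + c i • w i`, and some
points impose independent conditions on forms of degree `d`. -/
theorem exists_jetCoeff_surjective [CharZero k] {m : ℕ} {L : Fin m → Submodule k (Cone k n)}
    (hL : InGeneralPosition L) {v w : Fin m → Cone k n}
    (hli : ∀ i, LinearIndependent k ![v i, w i])
    (hspan : ∀ i, L i = Submodule.span k {v i, w i}) {r : Fin m → ℕ} (hr : Antitone r) {d χ : ℕ}
    (hsum : χ + ∑ i, r i ≤ (n + d).choose d) (hC : NumericalCondition n d r) :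
    ∃ (c : Fin m → k) (y : Fin χ → Cone k n), (∀ j, y j ≠ 0) ∧ Function.Surjective
      (jetCoeff d (Sum.elim (fun i => v i + c i • w i) y) (Sum.elim w fun _ => 0)
        (Sum.elim r fun _ => 1)) := by
  obtain ⟨c, hc⟩ := exists_forall_finrank_mixedSubspace_le
    (fun i => lineRestriction d (v i) (w i)) r Finset.univ
  have h1 := hc ∅ ((n + d).choose d - ∑ i, r i) fun T _ => by
    have h2 := finrank_iInf_ker_add_sum_le hL hli hspan hr (d := d) (by omega) hC T
    have h3 := Finset.sum_sdiff (f := r) (Finset.subset_univ T)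
    rw [Finset.union_empty]
    omega
  obtain ⟨y, hy0, hy⟩ := exists_finrank_inf_iInf_ker_le χ ((n + d).choose d - ∑ i, r i - χ) _
    (h1.trans (by omega))
  refine ⟨c, y, hy0, ?_⟩
  set τ := jetCoeff d (Sum.elim (fun i => v i + c i • w i) y) (Sum.elim w fun _ => 0)
    (Sum.elim r fun _ => 1)
  have hker : Module.finrank k (LinearMap.ker τ) ≤ (n + d).choose d - ∑ i, r i - χ := by
    refine (Submodule.finrank_mono fun p hp => ?_).trans hy
    have hp' : ∀ x, τ p x = 0 := fun x => congrFun hp x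
    refine ⟨?_, ?_⟩
    · simp only [mixedSubspace, Finset.mem_univ, iInf_pos, Finset.notMem_empty, iInf_false,
        iInf_top, inf_top_eq, Submodule.mem_iInf, SetLike.mem_coe, mem_vanishingAt]
      intro i
      rw [X_sub_C_pow_dvd_iff, lineRestriction_apply, ← lineEval_add_smul, X_pow_dvd_iff]
      exact fun a ha => hp' ⟨Sum.inl i, a, ha⟩
    · simp only [SetLike.mem_coe, Submodule.mem_iInf, LinearMap.mem_ker]
      exact fun j => hp' ⟨Sum.inr j, 0, one_pos⟩
  have hrank := τ.finrank_range_add_finrank_ker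
  rw [finrank_homogeneousSubmodule] at hrank
  refine LinearMap.range_eq_top.1 (Submodule.eq_top_of_finrank_eq
    (le_antisymm (Submodule.finrank_le _) ?_))
  rw [Module.finrank_fintype_fun_eq_card, Fintype.card_sigma]
  simp only [Fintype.card_fin, Fintype.sum_sum_type, Sum.elim_inl, Sum.elim_inr, Finset.sum_const,
    Finset.card_univ, smul_eq_mul, mul_one]
  omega

end JetCoefficients

/-! ### Sufficiency of the numerical condition -/

section Generic

/-- The linear form given by `φ` in the homogeneous coordinates of the point with index `i`. -/
def linearFormAt {ι : Type*} (i : ι) (φ : Module.Dual k (Cone k n)) :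
    MvPolynomial (ι × Fin (n + 1)) k :=
  MvPolynomial.rename (Prod.mk i) (linearForm φ)

theorem eval_linearFormAt {ι : Type*} (i : ι) (φ : Module.Dual k (Cone k n)) (v : ι → Cone k n) :
    MvPolynomial.eval (fun b => v b.1 b.2) (linearFormAt i φ) = φ (v i) := by
  rw [linearFormAt, MvPolynomial.eval_rename, ← eval_linearForm]
  rfl

theorem exists_frame {L : Submodule k (Cone k n)} (hL : Module.finrank k L = 2) {v : Cone k n}
    (hv : v ∈ L) (hv0 : v ≠ 0) :
    ∃ w, LinearIndependent k ![v, w] ∧ L = Submodule.span k {v, w} := by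
  obtain ⟨w, hwL, hw⟩ : ∃ w ∈ L, w ∉ Submodule.span k {v} := by
    by_contra! h
    have := Submodule.finrank_mono (show L ≤ Submodule.span k {v} from h)
    rw [hL, finrank_span_singleton hv0] at this
    omega
  have hli : LinearIndependent k ![v, w] := by
    rw [LinearIndependent.pair_iff' hv0]
    exact fun a ha => hw (Submodule.mem_span_singleton.2 ⟨a, ha⟩)
  refine ⟨w, hli, (Submodule.eq_of_le_of_finrank_eq (Submodule.span_le.2 ?_) ?_).symm⟩
  · rintro x (rfl | rfl)
    exacts [hv, hwL]
  · have h := finrank_span_eq_card hli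
    rw [Matrix.range_cons, Matrix.range_cons, Matrix.range_empty, Set.union_empty,
      Set.singleton_union] at h
    rw [h, hL, Fintype.card_fin]

theorem exists_frame_of_isLine {L : Submodule k (Cone k n)} (hL : Module.finrank k L = 2) :
    ∃ v w, LinearIndependent k ![v, w] ∧ L = Submodule.span k {v, w} := by
  have hne : L ≠ ⊥ := by
    rintro rfl
    simp at hL
  obtain ⟨v, hv, hv0⟩ := (Submodule.ne_bot_iff L).1 hne
  exact ⟨v, exists_frame hL hv hv0⟩

theorem frame_of_apply_ne_zero {L : Submodule k (Cone k n)} {v w x : Cone k n}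
    (hli : LinearIndependent k ![v, w]) (hL : L = Submodule.span k {v, w})
    {η : Module.Dual k (Cone k n)} (hη : η w = 0) (hx : x ∈ L) (hηx : η x ≠ 0) :
    LinearIndependent k ![x, w] ∧ L = Submodule.span k {x, w} := by
  rw [hL, Submodule.mem_span_pair] at hx
  obtain ⟨a, b, rfl⟩ := hx
  have ha : a ≠ 0 := by
    rintro rfl
    simp [hη] at hηx
  refine ⟨?_, ?_⟩
  · rw [LinearIndependent.pair_iff] at hli ⊢
    intro s t hst
    obtain ⟨h1, h2⟩ := hli (s * a) (s * b + t) (by rw [← hst]; module)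
    have hs : s = 0 := (mul_eq_zero.1 h1).resolve_right ha
    subst hs
    simpa using h2
  · rw [hL]
    refine le_antisymm (Submodule.span_le.2 ?_) (Submodule.span_le.2 ?_)
    · rintro y (rfl | rfl)
      · refine Submodule.mem_span_pair.2 ⟨a⁻¹, -(a⁻¹ * b), ?_⟩
        rw [smul_add, smul_smul, inv_mul_cancel₀ ha]
        module
      · exact Submodule.subset_span (by simp)
    · rintro y (rfl | rfl)
      · exact Submodule.mem_span_pair.2 ⟨a, b, rfl⟩
      · exact Submodule.subset_span (by simp)

theorem genericJetsAndPointsHaveMaximalRank [CharZero k] {m : ℕ}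
    {L : Fin m → Submodule k (Cone k n)} (hL : InGeneralPosition L) {r : Fin m → ℕ}
    (hr : Antitone r) {d χ : ℕ} (hsum : χ + ∑ i, r i ≤ (n + d).choose d)
    (hC : NumericalCondition n d r) : GenericJetsAndPointsHaveMaximalRank L χ r d := by
  choose v w hli hspan using fun i => exists_frame_of_isLine (hL.isLine i)
  choose η σ hηv hηw _ _ using fun i => exists_dual_pair (hli i)
  obtain ⟨c, y, hy0, hs⟩ := exists_jetCoeff_surjective hL hli hspan hr hsum hC
  obtain ⟨G, hG0, hG⟩ := exists_forall_jetCoeff_surjective hs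
  have hvL : ∀ i, v i ∈ L i := fun i => hspan i ▸ Submodule.subset_span (by simp)
  have hwL : ∀ i, w i ∈ L i := fun i => hspan i ▸ Submodule.subset_span (by simp)
  have hη : ∀ i, η i (v i + c i • w i) = 1 := fun i => by simp [hηv, hηw]
  have hbase : ∀ i, v i + c i • w i ∈ L i ∧ v i + c i • w i ≠ 0 := fun i =>
    ⟨(L i).add_mem (hvL i) ((L i).smul_mem _ (hwL i)), fun h => by
      have := hη i
      rw [h, map_zero] at this
      exact zero_ne_one this⟩
  refine ⟨G * ∏ i, linearFormAt (Sum.inl i) (η i), ⟨Sum.elim (fun i => v i + c i • w i) y,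
    Sum.forall.2 ⟨hbase, fun j => ⟨Submodule.mem_top, hy0 j⟩⟩, ?_⟩, fun x hx hxL hGx => ?_⟩
  · rw [map_mul, map_prod]
    refine mul_ne_zero hG0 (Finset.prod_ne_zero_iff.2 fun i _ => ?_)
    rw [eval_linearFormAt, Sum.elim_inl, hη]
    exact one_ne_zero
  · rw [map_mul, map_prod] at hGx
    have hηx : ∀ i, η i (x (Sum.inl i)) ≠ 0 := fun i => by
      have := Finset.prod_ne_zero_iff.1 (right_ne_zero_of_mul hGx) i (Finset.mem_univ i)
      rwa [eval_linearFormAt] at this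
    refine hasMaximalRank_of_jetCoeff_surjective hx (fun e p hp => ?_)
      (hG x (left_ne_zero_of_mul hGx))
    rw [Ideal.mem_inf, Ideal.mem_iInf, Ideal.mem_iInf, Sum.forall]
    refine and_congr (forall_congr' fun i => ?_) (forall_congr' fun j => ?_)
    · obtain ⟨h1, h2⟩ := frame_of_apply_ne_zero (hli i) (hspan i) (hηw i) (hxL (Sum.inl i)) (hηx i)
      exact mem_jetIdeal_iff h1 h2 _ hp _
    · rw [mem_linearIdeal_point_iff _ hp, Sum.elim_inr, Sum.elim_inr, pow_one,
        Polynomial.X_dvd_iff, coeff_zero_lineEval]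

theorem genericJetsHaveMaximalRank [CharZero k] {m : ℕ}
    {L : Fin m → Submodule k (Cone k n)} (hL : InGeneralPosition L) {r : Fin m → ℕ}
    (hr : Antitone r) {d : ℕ} (hsum : ∑ i, r i ≤ (n + d).choose d)
    (hC : NumericalCondition n d r) : GenericJetsHaveMaximalRank L r d := by
  obtain ⟨G, ⟨v, hv, hGv⟩, hG⟩ := genericJetsAndPointsHaveMaximalRank hL hr (χ := 0)
    (by rwa [zero_add]) hC
  have heval : ∀ x : Fin m → Cone k n, MvPolynomial.eval (fun b => x b.1 b.2)
      (MvPolynomial.rename (Prod.map (Sum.elim id Fin.elim0) id) G) =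
        MvPolynomial.eval (fun b => (Sum.elim x Fin.elim0 : Fin m ⊕ Fin 0 → Cone k n) b.1 b.2)
          G := by
    intro x
    rw [MvPolynomial.eval_rename]
    congr 2
    funext b
    rcases b with ⟨i | j, l⟩
    · rfl
    · exact j.elim0
  refine ⟨MvPolynomial.rename (Prod.map (Sum.elim id Fin.elim0) id) G,
    ⟨fun i => v (Sum.inl i), fun i => hv (Sum.inl i), ?_⟩, fun x hx hxL hGx => ?_⟩
  · refine ne_of_eq_of_ne (heval fun i => v (Sum.inl i)) ?_
    convert hGv using 4 with b
    rcases b with ⟨i | j, l⟩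
    · rfl
    · exact j.elim0
  · rw [heval] at hGx
    have h := hG (Sum.elim x Fin.elim0) (Sum.forall.2 ⟨hx, fun j => j.elim0⟩)
      (Sum.forall.2 ⟨hxL, fun j => j.elim0⟩) hGx
    beta_reduce at h
    rwa [iInf_of_empty (fun j : Fin 0 => linearIdeal _), inf_top_eq] at h

end Generic

/-! ### Necessity of the numerical condition -/

section Necessity
open Polynomial

/-- A product of linear subspaces is irreducible in the Zariski topology. -/
theorem exists_eval_mul_ne_zero [Infinite k] {ι : Type*} {W : ι → Submodule k (Cone k n)}
    {G H : MvPolynomial (ι × Fin (n + 1)) k}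
    (hG : ∃ v : ι → Cone k n, (∀ i, v i ∈ W i) ∧ MvPolynomial.eval (fun b => v b.1 b.2) G ≠ 0)
    (hH : ∃ v : ι → Cone k n, (∀ i, v i ∈ W i) ∧ MvPolynomial.eval (fun b => v b.1 b.2) H ≠ 0) :
    ∃ v : ι → Cone k n, (∀ i, v i ∈ W i) ∧
      MvPolynomial.eval (fun b => v b.1 b.2) (G * H) ≠ 0 := by
  obtain ⟨x, hx, hGx⟩ := hG
  obtain ⟨y, hy, hHy⟩ := hH
  -- Both polynomials restrict to nonzero polynomials on the affine line through `x` and `y`.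
  let ψ : MvPolynomial (ι × Fin (n + 1)) k →ₐ[k] k[X] :=
    MvPolynomial.aeval fun b => C (x b.1 b.2) + C (y b.1 b.2 - x b.1 b.2) * X
  have hψ : ∀ (c : k) (F : MvPolynomial (ι × Fin (n + 1)) k), (ψ F).eval c =
      MvPolynomial.eval (fun b => (x + c • (y - x)) b.1 b.2) F := by
    intro c F
    have h : (aeval c).comp ψ = MvPolynomial.aeval (fun b => (x + c • (y - x)) b.1 b.2) := by
      refine MvPolynomial.algHom_ext fun b => ?_
      simp [ψ, mul_comm c]
    exact congrArg (fun f => f F) h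
  have hne : ψ (G * H) ≠ 0 := by
    rw [map_mul]
    refine mul_ne_zero (fun h => hGx ?_) (fun h => hHy ?_)
    · have h0 := hψ 0 G
      rw [h, eval_zero, zero_smul, add_zero] at h0
      exact h0.symm
    · have h1 := hψ 1 H
      rw [h, eval_zero, one_smul, add_sub_cancel] at h1
      exact h1.symm
  obtain ⟨c, hc⟩ : ∃ c, (ψ (G * H)).eval c ≠ 0 := by
    by_contra! h
    exact hne (Polynomial.funext fun c => by rw [h c, eval_zero])
  refine ⟨x + c • (y - x), fun i => ?_, by rwa [← hψ]⟩
  exact (W i).add_mem (hx i) ((W i).smul_mem c ((W i).sub_mem (hy i) (hx i)))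

theorem exists_eval_prod_ne_zero [Infinite k] {ι α : Type*} {W : ι → Submodule k (Cone k n)}
    (s : Finset α) {H : α → MvPolynomial (ι × Fin (n + 1)) k}
    (hH : ∀ a ∈ s, ∃ v : ι → Cone k n, (∀ i, v i ∈ W i) ∧
      MvPolynomial.eval (fun b => v b.1 b.2) (H a) ≠ 0) :
    ∃ v : ι → Cone k n, (∀ i, v i ∈ W i) ∧
      MvPolynomial.eval (fun b => v b.1 b.2) (∏ a ∈ s, H a) ≠ 0 := by
  classical
  induction s using Finset.induction_on with
  | empty => exact ⟨0, fun i => (W i).zero_mem, by simp⟩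
  | insert a s ha ih =>
    rw [Finset.prod_insert ha]
    exact exists_eval_mul_ne_zero (hH a (Finset.mem_insert_self a s))
      (ih fun b hb => hH b (Finset.mem_insert_of_mem hb))

/-- If disjoint jets have total length at most the dimension of the space of forms and their union
has maximal rank, then they impose independent conditions. Disjointness enters through linear forms
`β i j` which vanish on the line `j` but not at the support of the jet `i`. -/
theorem jetCoeff_surjective_of_hasMaximalRank {m : ℕ} {v w : Fin m → Cone k n}
    (hli : ∀ i, LinearIndependent k ![v i, w i]) {β : Fin m → Fin m → Module.Dual k (Cone k n)}
    (hβ : ∀ i j, i ≠ j → β i j (v i) ≠ 0 ∧ β i j (v j) = 0 ∧ β i j (w j) = 0) {r : Fin m → ℕ}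
    {I : Ideal (CoordRing k n)} (hI : ∀ (e : ℕ) (p : CoordRing k n), p.IsHomogeneous e →
      (p ∈ I ↔ ∀ i, X ^ r i ∣ lineEval (v i) (w i) p)) {d : ℕ}
    (hsum : ∑ i, r i ≤ (n + d).choose d) (h : HasMaximalRank I d) :
    Function.Surjective (jetCoeff d v w r) := by
  rcases h with hinj | hsurj
  · have hτ : LinearMap.ker (jetCoeff d v w r) = ⊥ := by
      rw [LinearMap.ker_eq_bot']
      intro p hp
      refine Subtype.ext (mem_of_restriction_eq hinj p.2 ((hI d p.1 p.2).2 fun i => ?_))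
      rw [X_pow_dvd_iff]
      exact fun a ha => congrFun hp ⟨i, a, ha⟩
    have hrank := (jetCoeff d v w r).finrank_range_add_finrank_ker
    rw [hτ, finrank_bot, finrank_homogeneousSubmodule] at hrank
    refine LinearMap.range_eq_top.1 (Submodule.eq_top_of_finrank_eq
      (le_antisymm (Submodule.finrank_le _) ?_))
    rw [Module.finrank_fintype_fun_eq_card, Fintype.card_sigma]
    simp only [Fintype.card_fin]
    omega
  · intro y
    have hg : ∀ i, ∃ g : k[X], ∀ a : Fin (r i), g.coeff a = y ⟨i, a⟩ := by
      intro i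
      refine ⟨((degreeLTEquiv k (r i)).symm fun a => y ⟨i, a⟩).1, fun a => ?_⟩
      exact congrFun ((degreeLTEquiv k (r i)).apply_symm_apply fun a => y ⟨i, a⟩) a
    choose g hg using hg
    have hglue : ∀ l, ∃ p : CoordRing k n, p.IsHomogeneous (d + ((m - 1) + ∑ i, r i)) ∧
        ∀ i, jetEval (v i) (w i) (r i) p =
          jetEval (v i) (w i) (r i) (MvPolynomial.X l) ^ ((m - 1) + ∑ i, r i) *
            Ideal.Quotient.mk _ (g i) := by
      intro l
      have hq : ∀ i, ∃ q : CoordRing k n, q.IsHomogeneous (d + ∑ i, r i) ∧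
          jetEval (v i) (w i) (r i) ((∏ j ∈ Finset.univ.erase i, linearForm (β i j)) * q) =
            jetEval (v i) (w i) (r i) (MvPolynomial.X l) ^ ((m - 1) + ∑ i, r i) *
              Ideal.Quotient.mk _ (g i) := by
        intro i
        have hu : IsUnit (jetEval (v i) (w i) (r i)
            (∏ j ∈ Finset.univ.erase i, linearForm (β i j))) := by
          rw [map_prod]
          refine IsUnit.prod_iff.2 fun j hj => isUnit_mk_of_coeff_zero_ne_zero ?_ _
          change (lineEval _ _ _).coeff 0 ≠ 0
          rw [coeff_zero_lineEval, eval_linearForm]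
          exact (hβ i j (Finset.ne_of_mem_erase hj).symm).1
        obtain ⟨b, hb⟩ := hu.exists_right_inv
        obtain ⟨f, hf⟩ := Ideal.Quotient.mk_surjective (b *
          (jetEval (v i) (w i) (r i) (MvPolynomial.X l) ^ ((m - 1) + ∑ i, r i) *
              Ideal.Quotient.mk _ (g i)))
        have hdeg : (f %ₘ X ^ r i).natDegree ≤ d + ∑ i, r i := by
          refine (natDegree_modByMonic_le f (monic_X_pow _)).trans ?_
          rw [natDegree_X_pow]
          exact (Finset.single_le_sum (fun i _ => Nat.zero_le (r i)) (Finset.mem_univ i)).trans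
            (Nat.le_add_left _ _)
        obtain ⟨q, hq, hqf, -⟩ := exists_isHomogeneous_lineEval_eq (hli i) ((hli i).ne_zero 0)
          hdeg (r := 0) (by simp)
        refine ⟨q, hq, ?_⟩
        have hmk : jetEval (v i) (w i) (r i) q = Ideal.Quotient.mk _ f := by
          rw [jetEval_apply, hqf, Ideal.Quotient.eq, Ideal.mem_span_singleton]
          exact ⟨-(f /ₘ X ^ r i), by linear_combination modByMonic_add_div f (X ^ r i)⟩
        rw [map_mul, hmk, hf, ← mul_assoc, hb, one_mul]
      choose q hq hqe using hq
      refine ⟨∑ i, (∏ j ∈ Finset.univ.erase i, linearForm (β i j)) * q i, ?_, fun i => ?_⟩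
      · refine MvPolynomial.IsHomogeneous.sum _ _ _ fun i _ => ?_
        have h2 := (MvPolynomial.IsHomogeneous.prod (Finset.univ.erase i)
          (fun j => linearForm (β i j)) (fun _ => 1)
          fun j _ => isHomogeneous_linearForm (β i j)).mul (hq i)
        rwa [Finset.sum_const, smul_eq_mul, mul_one, Finset.card_erase_of_mem (Finset.mem_univ i),
          Finset.card_univ, Fintype.card_fin,
          show m - 1 + (d + ∑ i, r i) = d + (m - 1 + ∑ i, r i) by omega] at h2
      · rw [map_sum, Finset.sum_eq_single i, hqe]
        · intro j _ hji
          rw [map_mul, map_prod, Finset.prod_eq_zero (i := i), zero_mul]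
          · exact Finset.mem_erase.2 ⟨hji.symm, Finset.mem_univ i⟩
          · rw [jetEval_apply, lineEval_linearForm, (hβ j i hji).2.1, (hβ j i hji).2.2]
            simp
        · simp
    obtain ⟨p, hp, hpg⟩ := exists_forall_eq_of_restriction_surjective
      (fun i => jetEval (v i) (w i) (r i)) (fun e p hp => by
        rw [hI e p hp]
        exact forall_congr' fun i => (jetEval_eq_zero_iff _ _ _ _).symm)
      (fun i => (exists_isUnit_jetEval_X ((hli i).ne_zero 0) (w i) (r i)).imp fun l hl =>
        hl.mem_nonZeroDivisors) hsurj (fun i => Ideal.Quotient.mk _ (g i))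
      ((m - 1) + ∑ i, r i) hglue
    refine ⟨⟨p, hp⟩, funext fun x => ?_⟩
    rw [jetCoeff_apply, (jetEval_eq_mk_iff _ _ _ _ _).1 (hpg x.1) x.2 x.2.2, hg]

theorem le_of_jetCoeff_surjective {ι : Type*} {d : ℕ} {v w : ι → Cone k n} {r : ι → ℕ}
    (hs : Function.Surjective (jetCoeff d v w r)) (i : ι) : r i ≤ d + 1 := by
  by_contra! h
  obtain ⟨p, hp⟩ := hs fun _ => 1
  have h1 := congrFun hp ⟨i, d + 1, h⟩
  rw [jetCoeff_apply, coeff_eq_zero_of_natDegree_lt] at h1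
  · exact zero_ne_one h1
  · exact Nat.lt_succ_of_le (natDegree_lineEval_le _ _ p.2)

/-- Jets on `s` lines which lie on a product of `s` hyperplanes impose no conditions on its
multiples. -/
theorem sum_add_choose_le_of_jetCoeff_surjective {ι : Type*} [Fintype ι] {d : ℕ}
    {v w : ι → Cone k n} {r : ι → ℕ} (hs : Function.Surjective (jetCoeff d v w r))
    (hβ : ∀ i, ∃ β : Module.Dual k (Cone k n), β ≠ 0 ∧ β (v i) = 0 ∧ β (w i) = 0)
    (hd : Fintype.card ι ≤ d) :
    ∑ i, r i + (n + (d - Fintype.card ι)).choose (d - Fintype.card ι) ≤ (n + d).choose d := by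
  choose β hβ0 hβv hβw using hβ
  set F : CoordRing k n := ∏ i, linearForm (β i) with hF
  have hFhom : F.IsHomogeneous (Fintype.card ι) := by
    have h := MvPolynomial.IsHomogeneous.prod Finset.univ (fun i => linearForm (β i)) (fun _ => 1)
      fun i _ => isHomogeneous_linearForm (β i)
    rwa [Finset.sum_const, smul_eq_mul, mul_one, Finset.card_univ] at h
  have hF0 : F ≠ 0 := by
    refine Finset.prod_ne_zero_iff.2 fun i _ h0 => hβ0 i (LinearMap.ext fun x => ?_)
    rw [← eval_linearForm, h0, map_zero, LinearMap.zero_apply]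
  let μ : MvPolynomial.homogeneousSubmodule (Fin (n + 1)) k (d - Fintype.card ι) →ₗ[k]
      LinearMap.ker (jetCoeff d v w r) :=
    ((LinearMap.mulLeft k F).restrict (p := MvPolynomial.homogeneousSubmodule _ k _)
      (q := MvPolynomial.homogeneousSubmodule _ k d) fun q hq => by
        have h := hFhom.mul hq
        rwa [Nat.add_sub_cancel' hd] at h).codRestrict _ fun q => by
      refine LinearMap.mem_ker.2 (funext fun x => ?_)
      change (lineEval (v x.1) (w x.1) (F * q.1)).coeff x.2 = 0
      rw [map_mul, hF, map_prod, Finset.prod_eq_zero (Finset.mem_univ x.1), zero_mul, coeff_zero]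
      rw [lineEval_linearForm, hβv, hβw]
      simp
  have hμ : Function.Injective μ := by
    intro p q hpq
    refine Subtype.ext (mul_left_cancel₀ hF0 ?_)
    exact congrArg (fun x => x.1.1) hpq
  have h1 := LinearMap.finrank_le_finrank_of_injective hμ
  have h2 := (jetCoeff d v w r).finrank_range_add_finrank_ker
  rw [finrank_homogeneousSubmodule] at h1 h2
  rw [LinearMap.range_eq_top.2 hs, finrank_top, Module.finrank_fintype_fun_eq_card,
    Fintype.card_sigma] at h2
  simp only [Fintype.card_fin] at h2
  omega

theorem numericalCondition_of_jetCoeff_surjective {m : ℕ} {L : Fin m → Submodule k (Cone k n)}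
    (hL : ∀ i, Module.finrank k (L i) = 2) {v w : Fin m → Cone k n} (hv : ∀ i, v i ∈ L i)
    (hw : ∀ i, w i ∈ L i) {r : Fin m → ℕ} {d : ℕ} (hsum : ∑ i, r i ≤ (n + d).choose d)
    (hs : Function.Surjective (jetCoeff d v w r)) : NumericalCondition n d r := by
  refine ⟨fun h => le_of_jetCoeff_surjective hs _, ?_⟩
  rintro rfl s hs1 hsd
  set P : Finset (Fin m) := Finset.univ.filter fun i => i.val < s
  have hP : P.card ≤ s := by
    rw [Fin.card_filter_val_lt]
    exact min_le_right _ _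
  have hPsum : ∑ i ∈ P, r i ≤ (2 + d).choose d :=
    (Finset.sum_le_sum_of_subset (Finset.subset_univ P)).trans hsum
  have hN := two_mul_choose_two (d + 2)
  have h4 := two_mul_choose_two (s - 1)
  rw [two_add_choose] at hPsum
  rcases Nat.lt_or_ge d P.card with hcard | hcard
  · obtain rfl : s = d + 1 := by omega
    zify at hPsum ⊢
    rw [Nat.add_sub_cancel] at h4 ⊢
    push_cast at hN ⊢
    nlinarith
  · have hsP : Function.Surjective (jetCoeff d (fun i : P => v i) (fun i : P => w i)
        fun i : P => r i) := by
      let e : (Σ i : P, Fin (r i)) → Σ i, Fin (r i) := fun x => ⟨x.1.1, x.2⟩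
      have he : Function.Injective e := by
        rintro ⟨⟨i, hi⟩, a⟩ ⟨⟨j, hj⟩, b⟩ hab
        simp only [e, Sigma.mk.injEq] at hab
        obtain ⟨rfl, hab⟩ := hab
        rw [eq_of_heq hab]
      exact (LinearMap.funLeft_surjective_of_injective k k e he).comp hs
    have h1 := sum_add_choose_le_of_jetCoeff_surjective hsP (fun i => by
      obtain ⟨β, hβ0, hβ⟩ := Submodule.exists_le_ker_of_lt_top (L i)
        (lt_top_iff_ne_top.2 fun h => by
          have h2 := hL i
          rw [h, finrank_top, Module.finrank_fin_fun] at h2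
          omega)
      exact ⟨β, hβ0, hβ (hv i), hβ (hw i)⟩) (by rwa [Fintype.card_coe])
    rw [Fintype.card_coe, two_add_choose, two_add_choose,
      Finset.sum_coe_sort P (fun i => r i)] at h1
    have h3 := two_mul_choose_two (d - P.card + 2)
    zify [hcard, hs1] at h1 h3 h4 ⊢
    push_cast at hN
    have h5 : (P.card : ℤ) ≤ s := by exact_mod_cast hP
    have h6 : (s : ℤ) ≤ d + 1 := by exact_mod_cast hsd
    nlinarith

end Necessity

theorem numericalCondition_of_genericJetsHaveMaximalRank [CharZero k] {m : ℕ}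
    {L : Fin m → Submodule k (Cone k n)} (hL : InGeneralPosition L) {r : Fin m → ℕ} {d : ℕ}
    (hsum : ∑ i, r i ≤ (n + d).choose d) (h : GenericJetsHaveMaximalRank L r d) :
    NumericalCondition n d r := by
  obtain ⟨G, ⟨v₀, hv₀, hGv₀⟩, hG⟩ := h
  have hβ : ∀ i j, ∃ β : Module.Dual k (Cone k n), (i ≠ j → ∀ x ∈ L j, β x = 0) ∧
      ∃ x ∈ L i, β x ≠ 0 := by
    intro i j
    by_cases hij : i = j
    · obtain ⟨x, w, hli, hspan⟩ := exists_frame_of_isLine (hL.isLine i)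
      obtain ⟨η, σ, hη, -⟩ := exists_dual_pair hli
      exact ⟨η, fun h => absurd hij h, x, hspan ▸ Submodule.subset_span (by simp),
        by rw [hη]; exact one_ne_zero⟩
    · obtain ⟨β, h1, h2⟩ := exists_dual_of_ne (hL.isLine j) (hL.isLine i)
        (hL.distinct.ne (Ne.symm hij))
      exact ⟨β, fun _ => h1, h2⟩
  choose β hβ0 hβ using hβ
  obtain ⟨v, hvL, hv⟩ := exists_eval_mul_ne_zero (W := L) ⟨v₀, fun i => (hv₀ i).1, hGv₀⟩
    (exists_eval_prod_ne_zero (Finset.univ : Finset (Fin m × Fin m))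
      (H := fun a => linearFormAt a.1 (β a.1 a.2)) fun a _ => by
        obtain ⟨x, hx, hβx⟩ := hβ a.1 a.2
        refine ⟨Function.update 0 a.1 x, fun i => ?_, ?_⟩
        · rcases eq_or_ne i a.1 with rfl | hi
          · rwa [Function.update_self]
          · rw [Function.update_of_ne hi]
            exact (L i).zero_mem
        · rwa [eval_linearFormAt, Function.update_self])
  rw [map_mul, map_prod] at hv
  have hβv : ∀ i j, β i j (v i) ≠ 0 := fun i j => by
    have := Finset.prod_ne_zero_iff.1 (right_ne_zero_of_mul hv) (i, j) (Finset.mem_univ _)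
    rwa [eval_linearFormAt] at this
  have hv0 : ∀ i, v i ≠ 0 := fun i h => hβv i i (by rw [h, map_zero])
  choose w hli hspan using fun i => exists_frame (hL.isLine i) (hvL i) (hv0 i)
  have hwL : ∀ i, w i ∈ L i := fun i => hspan i ▸ Submodule.subset_span (by simp)
  refine numericalCondition_of_jetCoeff_surjective hL.isLine hvL hwL hsum
    (jetCoeff_surjective_of_hasMaximalRank hli (β := β) (fun i j hij =>
      ⟨hβv i j, hβ0 i j hij _ (hvL j), hβ0 i j hij _ (hwL j)⟩) (fun e p hp => ?_) hsum
      (hG v hv0 hvL (left_ne_zero_of_mul hv)))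
  rw [Ideal.mem_iInf]
  exact forall_congr' fun i => mem_jetIdeal_iff (hli i) (hspan i) (hv0 i) hp (r i)

end JetInterpolation

end

theorem theorem1p2 {k : Type*} [Field k] [CharZero k] {n m : ℕ}
    (L : Fin m → Submodule k (JetInterpolation.Cone k n))
    (hL : JetInterpolation.InGeneralPosition L)
    (r : Fin m → ℕ) (hpos : ∀ i, 0 < r i) (hanti : Antitone r)
    (d : ℕ) (hsum : ∑ i, r i ≤ (n + d).choose d) :
    (JetInterpolation.GenericJetsHaveMaximalRank L r d ↔
      JetInterpolation.NumericalCondition n d r) ∧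
    (∀ χ : ℕ, JetInterpolation.IsAdmissible n d χ r →
      JetInterpolation.GenericJetsAndPointsHaveMaximalRank L χ r d) := by
  exact ⟨⟨JetInterpolation.numericalCondition_of_genericJetsHaveMaximalRank hL hsum,
    JetInterpolation.genericJetsHaveMaximalRank hL hanti hsum⟩, fun χ h =>
    JetInterpolation.genericJetsAndPointsHaveMaximalRank hL hanti h.sum_eq.le h.condition⟩
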